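/- Let $(I,v)$ be an instance of 2-dimensional Vector Bin Packing (2VBP): $I$ is a finite set of items and $v:I\to[0,1]^2$. A configuration is a set $C\subseteq I$ with $\sum_{i\in C}v(i)\le(1,1)$; $\mathcal C$ is the set of configurations. $\mathrm{OPT}$ is the minimum number of configurations into which $I$ can be partitioned. For $z\in[0,1]^I$ let $\mathrm{OPT}_f(z)$ be the minimum of $\sum_{C\in\mathcal C}x_C$ over all $x\in\mathbb R_{\ge0}^{\mathcal C}$ with $\sum_{C\ni i}x_C=z_i$ for all $i\in I$. For $u\in\mathbb R^I$ let $\mathrm{tol}(u)=\max_{C\in\mathcal C}\sum_{i\in C}u_i$ and $\mathrm{supp}(u)=\{i: u_i>0\}$. A multi-configuration is a function $C:I\to\mathbb N$ with $v(C):=\sum_i C(i)v(i)\le(1,1)$; $\mathcal C^*$ is the set of multi-configurations. For $\bar\lambda\in[0,1]^{\mathcal C^*}$ let $\|\bar\lambda\|=\sum_C\bar\lambda_C$; its coverage is $\bar w$ with $\bar w_i=\sum_{C}\bar\lambda_C\,C(i)$, and we only consider $\bar\lambda$ with (convergent) coverage $\bar w\in[0,1]^I$. Let $\delta\in(0,0.1)$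 with $\delta^{-1}\in\mathbb N$. The instance is $\delta$-huge-free if no item $i$ has $v_1(i)\ge1-\delta$ and $v_2(i)\ge1-\delta$. Let $L$ be the set of items $i$ with $v_1(i)>\delta$ or $v_2(i)>\delta$. A vector $y\in[0,1]^I$ is small-items integral if $y_i\in\{0,1\}$ for all $i\in I\setminus L$, and $\bar\lambda$ is small-items integral if its coverage is. $\bar\lambda$ is with $\delta$-slack if every $C$ with $\bar\lambda_C>0$ satisfies $v_1(C)\le1-\delta$ or $v_2(C)\le1-\delta$. For $K>0$, a $(\delta,K)$-linear structure of $\bar\lambda$ (with coverage $\bar w$) is a set $\mathcal S\subseteq\mathbb R^I_{\ge0}$ with $|\mathcal S|\le K$ such that for every small-items integral $z\in[0,1]^I$ and every $\beta\in[\delta^5,1]$ with $\mathrm{supp}(z)\subseteq\mathrm{supp}(\bar w)$ and $$z\cdot u\le\beta\,\bar w\cdot u+\frac1{K^{10}}\,\mathrm{OPT}\cdot\mathrm{tol}(u)\quad\text{for all }u\in\mathcal S,$$ it holds that $\mathrm{OPT}_f(z)\le\beta(1+10\delta)\|\bar\lambda\|+K+\delta^{10}\,\mathrm{OPT}$. Theorem.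 Let $\delta\in(0,0.1)$ with $\delta^{-1}\in\mathbb N$, let $(I,v)$ be a $\delta$-huge-free 2VBP instance, and let $\varphi(\delta)=\exp(\delta^{-20})$. There is a set $\mathcal S^*\subseteq\mathbb R^I_{\ge0}$ with $|\mathcal S^*|\le\varphi(\delta)\,|L|^4$ such that for every small-items integral $\bar\lambda\in[0,1]^{\mathcal C^*}$ with $\delta$-slack there is a $(\delta,\varphi(\delta))$-linear structure $\mathcal S$ of $\bar\lambda$ such that every $u\in\mathcal S$ with $\mathrm{supp}(u)\cap L\ne\emptyset$ belongs to $\mathcal S^*$. -/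

import Mathlib

/-- An instance `(I, v)` of two-dimensional vector bin packing on the item set `I`:
every item has a volume vector in `[0,1]^2`. -/
structure VBP2 (I : Type*) where
  v : I → Fin 2 → ℝ
  v_nonneg : ∀ i d, 0 ≤ v i d
  v_le_one : ∀ i d, v i d ≤ 1

namespace VBP2

variable {I : Type*} [Fintype I] (P : VBP2 I)

/-- A configuration: a set of items whose total volume is at most `1` in each dimension. -/
def Config : Type _ := {C : Finset I // ∀ d, ∑ i ∈ C, P.v i d ≤ 1}

noncomputable instance : Fintype P.Config :=
  inferInstanceAs (Fintype {C : Finset I // ∀ d, ∑ i ∈ C, P.v i d ≤ 1})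

instance : Nonempty P.Config := ⟨⟨∅, by simp⟩⟩

/-- The volume of a multi-set of items in dimension `d`. -/
def mvol (C : I → ℕ) (d : Fin 2) : ℝ := ∑ i, (C i : ℝ) * P.v i d

/-- A multi-configuration: a multi-set of items whose total volume is at most `1` in each
dimension. -/
def MultiConfig : Type _ := {C : I → ℕ // ∀ d, P.mvol C d ≤ 1}

/-- The optimum of the instance: the least `m` such that the items can be partitioned into `m`
configurations (some of which may be empty). -/
noncomputable def OPT : ℕ :=
  sInf {m : ℕ | ∃ A : Fin m → P.Config, ∀ i, ∃! b, i ∈ (A b).1}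

open Classical in
/-- `x` is a feasible solution of the configuration LP with demand vector `dem`. -/
def DemandLPFeasible (dem : I → ℝ) (x : P.Config → ℝ) : Prop :=
  (∀ C, 0 ≤ x C) ∧ ∀ i, ∑ C : P.Config, x C * (if i ∈ C.1 then 1 else 0) = dem i

/-- The optimal value of the configuration LP with demand vector `dem`. -/
noncomputable def OPTf (dem : I → ℝ) : ℝ :=
  sInf {a : ℝ | ∃ x : P.Config → ℝ, P.DemandLPFeasible dem x ∧ a = ∑ C, x C}

/-- The tolerance of `u`: the largest total `u`-weight of a configuration. -/
noncomputable def tol (u : I → ℝ) : ℝ := ⨆ C : P.Config, ∑ i ∈ C.1, u i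

/-- An item is `δ`-huge if its volume is at least `1 - δ` in both dimensions. -/
def IsHuge (δ : ℝ) (i : I) : Prop := ∀ d, 1 - δ ≤ P.v i d

/-- An instance is `δ`-huge free if it has no `δ`-huge item. -/
def HugeFree (δ : ℝ) : Prop := ∀ i, ¬ P.IsHuge δ i

open Classical in
/-- The set `L` of `δ`-large items: those of volume more than `δ` in some dimension. -/
noncomputable def large (δ : ℝ) : Finset I := {i | ∃ d, δ < P.v i d}

/-- The coverage of a vector indexed by the multi-configurations. -/
noncomputable def coverage (lam : P.MultiConfig → ℝ) (i : I) : ℝ :=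
  ∑' C : P.MultiConfig, lam C * (C.1 i : ℝ)

/-- `lam ∈ [0,1]^(MultiConfig)` with a (well-defined) coverage in `[0,1]^I`.
If no item has volume `(0, 0)`, there are only finitely many multi-configurations and the
summability is automatic. -/
structure IsFractional (lam : P.MultiConfig → ℝ) : Prop where
  mem : ∀ C, lam C ∈ Set.Icc (0 : ℝ) 1
  summable : ∀ i, Summable fun C : P.MultiConfig => lam C * (C.1 i : ℝ)
  coverage_le : ∀ i, P.coverage lam i ≤ 1

/-- The norm `‖lam‖ = ∑ lam_C`. -/
noncomputable def norm1 (lam : P.MultiConfig → ℝ) : ℝ := ∑' C, lam C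

/-- A vector in `ℝ^I` is small-items integral if its entries at the items that are not `δ`-large
are `0` or `1`. -/
def SmallItemsIntegral (δ : ℝ) (y : I → ℝ) : Prop :=
  ∀ i, i ∉ P.large δ → y i = 0 ∨ y i = 1

/-- `lam` is with `δ`-slack: every multi-configuration in its support has volume at most `1 - δ`
in at least one dimension. -/
def WithSlack (δ : ℝ) (lam : P.MultiConfig → ℝ) : Prop :=
  ∀ C, 0 < lam C → ∃ d, P.mvol C.1 d ≤ 1 - δ

/-- `S` is a `(δ, K)`-linear structure of `lam`. -/
structure IsLinearStructure (δ K : ℝ) (lam : P.MultiConfig → ℝ) (S : Finset (I → ℝ)) : Prop where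
  nonneg : ∀ u ∈ S, ∀ i, 0 ≤ u i
  card_le : (S.card : ℝ) ≤ K
  bound : ∀ (z : I → ℝ) (β : ℝ), (∀ i, z i ∈ Set.Icc (0 : ℝ) 1) → P.SmallItemsIntegral δ z →
    β ∈ Set.Icc (δ ^ 5) 1 →
    (∀ i, 0 < z i → 0 < P.coverage lam i) →
    (∀ u ∈ S, ∑ i, z i * u i ≤
      β * ∑ i, P.coverage lam i * u i + 1 / K ^ 10 * (P.OPT : ℝ) * P.tol u) →
    P.OPTf z ≤ β * (1 + 10 * δ) * P.norm1 lam + K + δ ^ 10 * (P.OPT : ℝ)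

/-- The singleton configuration. -/
def single (i : I) : P.Config := ⟨{i}, by simpa using P.v_le_one i⟩

/-- There is a packing, so that `OPT` is a minimum over a nonempty set. -/
theorem packing_nonempty :
    {m : ℕ | ∃ A : Fin m → P.Config, ∀ i, ∃! b, i ∈ (A b).1}.Nonempty := by
  refine ⟨Fintype.card I, fun b => P.single ((Fintype.equivFin I).symm b), fun i => ?_⟩
  refine ⟨Fintype.equivFin I i, by simp [single], fun b hb => ?_⟩
  have h : i = (Fintype.equivFin I).symm b := by simpa [single] using hb
  simp [h]

open Classical in
/-- The configuration LP is feasible for every nonnegative demand vector, so that `OPTf` is the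
infimum of a nonempty set of nonnegative reals. -/
theorem demandLP_feasible (dem : I → ℝ) (h : ∀ i, 0 ≤ dem i) :
    ∃ x : P.Config → ℝ, P.DemandLPFeasible dem x := by
  refine ⟨fun C => ∑ i, if C = P.single i then dem i else 0, fun C => ?_, fun i => ?_⟩
  · exact Finset.sum_nonneg fun i _ => by split_ifs <;> simp [h]
  · simp_rw [Finset.sum_mul]
    rw [Finset.sum_comm]
    have key : ∀ j, (∑ C : P.Config, (if C = P.single j then dem j else 0) *
        (if i ∈ C.1 then (1 : ℝ) else 0)) = if i = j then dem j else 0 := by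
      intro j
      rw [Finset.sum_eq_single (P.single j) (fun C _ hC => by rw [if_neg hC, zero_mul])
        (fun hn => absurd (Finset.mem_univ _) hn)]
      have hm : i ∈ (P.single j).1 ↔ i = j := by simp [single]
      rw [if_pos rfl]
      simp only [hm, mul_ite, mul_one, mul_zero]
    rw [Finset.sum_congr rfl fun j _ => key j]
    simp

/-- The norm of a fractional vector is the sum of a convergent series. -/
theorem IsFractional.summable_self {lam : P.MultiConfig → ℝ} (h : P.IsFractional lam) :
    Summable lam := by
  classical
  have h0 : Summable fun C : P.MultiConfig => if C.1 = 0 then lam C else 0 := by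
    refine summable_of_hasFiniteSupport (Set.Subsingleton.finite ?_)
    intro C hC D hD
    have h1 : C.1 = 0 := by by_contra hne; simp [hne] at hC
    have h2 : D.1 = 0 := by by_contra hne; simp [hne] at hD
    exact Subtype.ext (h1.trans h2.symm)
  have h1 := h0.add (summable_sum (s := Finset.univ) fun i _ => h.summable i)
  refine Summable.of_nonneg_of_le (fun C => (h.mem C).1) (fun C => ?_) h1
  have hn : ∀ i ∈ Finset.univ, 0 ≤ lam C * (C.1 i : ℝ) :=
    fun i _ => mul_nonneg (h.mem C).1 (Nat.cast_nonneg _)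
  by_cases hC : C.1 = 0
  · simp [hC]
  · obtain ⟨i, hi⟩ := Function.ne_iff.mp hC
    have h3 : (1 : ℝ) ≤ (C.1 i : ℝ) := by exact_mod_cast Nat.one_le_iff_ne_zero.mpr hi
    have h4 := Finset.single_le_sum hn (Finset.mem_univ i)
    have h5 : lam C ≤ lam C * (C.1 i : ℝ) := le_mul_of_one_le_right (h.mem C).1 h3
    simpa [hC] using h5.trans h4

end VBP2

/-- `φ(δ) = exp(δ^(-20))`. -/
noncomputable def vbpPhi (δ : ℝ) : ℝ := Real.exp (δ ^ (-20 : ℤ))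

/-! Write n = 1/δ and N for the norm of the given fractional solution. Every multi-configuration in
its support has slack δ in some dimension; call the other dimension e. The demand z is packed by
imitating the solution: each large item takes the place of one that is at least as big in dimension
e, and a slight excess in the other dimension is paid by the slack.

Round volumes down to a grid of mesh 1/(4n²), giving boxes. For each e, cut the large items of a
box, ordered by volume in dimension e, into n² stripes of nearly equal weight, where the weight
counts only multi-configurations assigned to e. An item of z in one stripe uses a slot held in the
solution by an item of the next stripe. A bin has at most 2n large items, so the exchange costs at
most 2n/(4n²) = δ/2 in the slack dimension. The top stripes have no successor; up to additive terms
they hold a 1/n² fraction of the large mass, which is at most 2nN, and one configuration per item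
costs about 2βN/n. The constraints needed are one per cell, that is, per intersection of a box with
a stripe of each order: inside a cell z can be split between the two choices of e in proportion to
the supplies (`exists_split`). A nonempty cell is determined by its box and by four large items, its
extremes in both orders. Hence the |L|⁴ candidate vectors that do not depend on the solution
(`rectangles`).

For small items, group the multi-configurations into types: e together with the number of large
items in each slot. Each type leaves a space r for small items, and z is shared among the types as
the small coverage is. The additive error in the constraints is harmless only if tol is comparable
to r, which can fail in the tight dimension e. The steep items, which cause this, have total volume
O(N/n²) and are packed apart; for the flat ones tol is at most n²r, so a few extra bins of the type
absorb the error (`tol_flatVec_le`, `sum_steepVec_le`). A fractional filling under two volume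
constraints rounds with at most two fractional items per bin, and these are packed n to a
configuration. Altogether the factor is (1+2δ)(1+2δ²)+2δ ≤ 1+10δ, and all remaining terms are
dominated by φ(δ) and δ¹⁰ OPT (`cost_le`). -/

open Classical in
/-- The indicator vector of a finite set of items. -/
noncomputable def finInd {I : Type*} (A : Finset I) (i : I) : ℝ := if i ∈ A then 1 else 0

theorem finInd_nonneg {I : Type*} (A : Finset I) (i : I) : 0 ≤ finInd A i := by
  unfold finInd
  split_ifs <;> simp

theorem finInd_le_one {I : Type*} (A : Finset I) (i : I) : finInd A i ≤ 1 := by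
  unfold finInd
  split_ifs <;> simp

/-- The set of coordinates of `y` lying strictly between `0` and `1`. -/
noncomputable def fracSet {I : Type*} [Fintype I] (y : I → ℝ) : Finset I :=
  open Classical in {i | 0 < y i ∧ y i < 1}

/-! ### Rounding points of the cube along directions that preserve constraints -/

section Rounding

variable {I : Type*} [Fintype I]

theorem mem_fracSet {y : I → ℝ} {i : I} : i ∈ fracSet y ↔ 0 < y i ∧ y i < 1 := by
  simp [fracSet]

/-- Along a direction supported on the fractional coordinates, one can move until a fractional
coordinate becomes integral. -/
theorem exists_move (y h : I → ℝ) (hy : ∀ i, y i ∈ Set.Icc (0 : ℝ) 1) (h0 : h ≠ 0)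
    (hs : ∀ i, h i ≠ 0 → i ∈ fracSet y) :
    ∃ t : ℝ, 0 < t ∧ (∀ i, y i + t * h i ∈ Set.Icc (0 : ℝ) 1) ∧
      (fracSet (fun i => y i + t * h i)).card < (fracSet y).card := by
  classical
  set F : Finset I := {i | h i ≠ 0} with hF
  have hne : F.Nonempty := by
    obtain ⟨i, hi⟩ := Function.ne_iff.mp h0
    exact ⟨i, by simpa [hF] using hi⟩
  -- `g i` is the time at which coordinate i reaches a facet of the cube; the first such time is the
  -- step length.
  set g : I → ℝ := fun i => if 0 < h i then (1 - y i) / h i else y i / (-h i) with hg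
  obtain ⟨j, hj, hmin⟩ := F.exists_min_image g hne
  have hjh : h j ≠ 0 := by simpa [hF] using hj
  have hjf := mem_fracSet.mp (hs j hjh)
  have hpos : 0 < g j := by
    simp only [hg]
    split_ifs with hc
    · exact div_pos (by linarith [hjf.2]) hc
    · have : h j < 0 := lt_of_le_of_ne (not_lt.mp hc) hjh
      exact div_pos hjf.1 (by linarith)
  have hbox : ∀ i, y i + g j * h i ∈ Set.Icc (0 : ℝ) 1 := by
    intro i
    by_cases hi : h i = 0
    · simpa [hi] using hy i
    have hm := hmin i (by simpa [hF] using hi)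
    have hyi := hy i
    rcases lt_or_gt_of_ne hi with hlt | hgt
    · have e : g i = y i / (-h i) := by simp [hg, not_lt.mpr hlt.le]
      rw [e, le_div_iff₀ (by linarith)] at hm
      constructor
      · linarith
      · nlinarith [hyi.2]
    · have e : g i = (1 - y i) / h i := by simp [hg, hgt]
      rw [e, le_div_iff₀ hgt] at hm
      constructor
      · nlinarith [hyi.1]
      · linarith
  refine ⟨g j, hpos, hbox, Finset.card_lt_card ?_⟩
  rw [Finset.ssubset_iff_of_subset]
  · refine ⟨j, hs j hjh, ?_⟩
    rw [mem_fracSet]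
    rintro ⟨h1, h2⟩
    rcases lt_or_gt_of_ne hjh with hlt | hgt
    · have e : g j = y j / (-h j) := by simp [hg, not_lt.mpr hlt.le]
      have : y j + g j * h j = 0 := by rw [e]; field_simp; ring
      linarith
    · have e : g j = (1 - y j) / h j := by simp [hg, hgt]
      have : y j + g j * h j = 1 := by rw [e]; field_simp; ring
      linarith
  · intro i hi
    by_cases hi0 : h i = 0
    · simpa [mem_fracSet, hi0] using hi
    · exact hs i hi0

/-- If from every non-terminal point of a part `good` of the cube there is a direction, supported
on the fractional coordinates, along which one stays in `good`, then every point of `good` is a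
convex combination of terminal points. -/
theorem mem_convexHull_of_moves (good term : (I → ℝ) → Prop)
    (step : ∀ y, (∀ i, y i ∈ Set.Icc (0 : ℝ) 1) → good y → ¬ term y →
      ∃ h : I → ℝ, h ≠ 0 ∧ (∀ i, h i ≠ 0 → i ∈ fracSet y) ∧
        ∀ t : ℝ, (∀ i, y i + t * h i ∈ Set.Icc (0 : ℝ) 1) → good (fun i => y i + t * h i))
    (y : I → ℝ) (hy : ∀ i, y i ∈ Set.Icc (0 : ℝ) 1) (hg : good y) :
    y ∈ convexHull ℝ {y : I → ℝ | (∀ i, y i ∈ Set.Icc (0 : ℝ) 1) ∧ good y ∧ term y} := by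
  induction hn : (fracSet y).card using Nat.strong_induction_on generalizing y with
  | _ n ih =>
    by_cases ht : term y
    · exact subset_convexHull ℝ _ ⟨hy, hg, ht⟩
    obtain ⟨h, h0, hs, hgood⟩ := step y hy hg ht
    -- Moving along h and along -h both lose a fractional coordinate, and y is the combination of
    -- the two exit points with weights s/(s+t) and t/(s+t).
    obtain ⟨t, ht0, htb, htc⟩ := exists_move y h hy h0 hs
    obtain ⟨s, hs0, hsb, hsc⟩ := exists_move y (-h) hy (neg_ne_zero.mpr h0)
      (fun i hi => hs i (by simpa using hi))
    have e : ∀ i, y i + s * (-h) i = y i + (-s) * h i := fun i => by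
      simp only [Pi.neg_apply]; ring
    simp only [e] at hsb hsc
    have m1 := ih _ (hn ▸ htc) _ htb (hgood t htb) rfl
    have m2 := ih _ (hn ▸ hsc) _ hsb (hgood (-s) hsb) rfl
    have hst : 0 < s + t := by linarith
    have := (convex_convexHull ℝ
      {y : I → ℝ | (∀ i, y i ∈ Set.Icc (0 : ℝ) 1) ∧ good y ∧ term y}) m1 m2
      (a := s / (s + t)) (b := t / (s + t)) (by positivity) (by positivity) (by field_simp)
    convert this using 1
    funext i
    simp only [Pi.add_apply, Pi.smul_apply, smul_eq_mul]
    field_simp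
    ring

/-- A vector of the cube whose sums over the classes of `σ` are bounded by integers is a convex
combination of indicator vectors of sets which obey the same bounds. -/
theorem mem_convexHull_of_class_bounds {ι : Type*} [DecidableEq ι] (σ : I → ι) (T : ι → ℕ)
    (y : I → ℝ) (hy : ∀ i, y i ∈ Set.Icc (0 : ℝ) 1)
    (hT : ∀ s, ∑ i with σ i = s, y i ≤ T s) :
    y ∈ convexHull ℝ {x : I → ℝ | ∃ A : Finset I, x = finInd A ∧ (∀ i ∈ A, 0 < y i) ∧
      ∀ s, (A.filter fun i => σ i = s).card ≤ T s} := by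
  classical
  have key := mem_convexHull_of_moves
    (fun x : I → ℝ => (∀ i, y i = 0 → x i = 0) ∧ ∀ s, ∑ i with σ i = s, x i ≤ T s)
    (fun x => fracSet x = ∅) ?_ y hy ⟨fun i h => h, hT⟩
  · refine convexHull_mono ?_ key
    rintro x ⟨hx, ⟨hx0, hxT⟩, hxf⟩
    have h01 : ∀ i, x i = 0 ∨ x i = 1 := by
      intro i
      by_contra! hc
      have : i ∈ fracSet x := mem_fracSet.mpr
        ⟨lt_of_le_of_ne (hx i).1 (Ne.symm hc.1), lt_of_le_of_ne (hx i).2 hc.2⟩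
      simp [hxf] at this
    have hxA : x = finInd ({i | x i = 1} : Finset I) := by
      funext i
      rcases h01 i with h | h <;> simp [finInd, h]
    refine ⟨({i | x i = 1} : Finset I), hxA, ?_, ?_⟩
    · intro i hi
      simp only [Finset.mem_filter, Finset.mem_univ, true_and] at hi
      refine lt_of_le_of_ne (hy i).1 fun h => ?_
      have := hx0 i h.symm
      linarith
    · intro s
      have h1 := hxT s
      have h2 : ∑ i with σ i = s, x i
          = ((({i | x i = 1} : Finset I).filter fun i => σ i = s).card : ℝ) := by
        rw [Finset.filter_filter, Finset.card_filter, Finset.sum_filter]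
        push_cast
        refine Finset.sum_congr rfl fun i _ => ?_
        rcases h01 i with h | h <;> simp [h]
      rw [h2] at h1
      exact_mod_cast h1
  · rintro x hx ⟨hx0, hxT⟩ hxf
    obtain ⟨i, hi⟩ := Finset.nonempty_iff_ne_empty.mpr hxf
    have hi' := mem_fracSet.mp hi
    have supp : ∀ k, k ∈ fracSet x → y k ≠ 0 := fun k hk h => by
      have := hx0 k h
      have := (mem_fracSet.mp hk).1
      linarith
    -- Two fractional coordinates of one class can be traded against each other without changing any
    -- class sum.
    by_cases hex : ∃ j ∈ fracSet x, j ≠ i ∧ σ j = σ i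
    · obtain ⟨j, hj, hji, hσ⟩ := hex
      refine ⟨Pi.single i 1 - Pi.single j 1, fun h => ?_, fun k hk => ?_, fun t _ => ⟨?_, ?_⟩⟩
      · have := congrFun h i
        simp [hji.symm] at this
      · by_cases h1 : k = i
        · exact h1 ▸ hi
        · by_cases h2 : k = j
          · exact h2 ▸ hj
          · simp [h1, h2] at hk
      · intro k hk
        have h1 : k ≠ i := fun h => supp i hi (h ▸ hk)
        have h2 : k ≠ j := fun h => supp j hj (h ▸ hk)
        simp [h1, h2, hx0 k hk]
      · intro s
        rw [Finset.sum_add_distrib, ← Finset.mul_sum]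
        have : ∑ k with σ k = s, (Pi.single i 1 - Pi.single j 1 : I → ℝ) k = 0 := by
          simp [Pi.single_apply, hσ, Finset.sum_ite_eq', Finset.mem_filter]
        rw [this]
        simpa using hxT s
    -- A lone fractional coordinate in its class: the others sum to an integer N below the integer
    -- bound, so N + 1 still obeys it and the coordinate moves freely in [0,1].
    · push Not at hex
      refine ⟨Pi.single i 1, fun h => ?_, fun k hk => ?_, fun t ht => ⟨?_, ?_⟩⟩
      · have := congrFun h i
        simp at this
      · by_cases h1 : k = i
        · exact h1 ▸ hi
        · simp [h1] at hk
      · intro k hk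
        have h1 : k ≠ i := fun h => supp i hi (h ▸ hk)
        simp [h1, hx0 k hk]
      · intro s
        by_cases hs : σ i = s
        · subst hs
          have hmem : i ∈ ({k | σ k = σ i} : Finset I) := by simp
          rw [← Finset.add_sum_erase _ _ hmem]
          have hTi := hxT (σ i)
          rw [← Finset.add_sum_erase _ _ hmem] at hTi
          have e : ∑ k ∈ ({k | σ k = σ i} : Finset I).erase i, (x k + t * (Pi.single i 1 : I → ℝ) k)
              = ∑ k ∈ ({k | σ k = σ i} : Finset I).erase i, x k := by
            refine Finset.sum_congr rfl fun k hk => ?_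
            simp [(Finset.mem_erase.mp hk).1]
          have hint : ∃ N : ℕ, ∑ k ∈ ({k | σ k = σ i} : Finset I).erase i, x k = N := by
            refine ⟨(({k | σ k = σ i} : Finset I).erase i |>.filter fun k => x k = 1).card, ?_⟩
            rw [Finset.card_filter]
            push_cast
            refine Finset.sum_congr rfl fun k hk => ?_
            have hk' := Finset.mem_erase.mp hk
            have hnf : k ∉ fracSet x := fun hf => hex k hf hk'.1 (by simpa using hk'.2)
            rw [mem_fracSet] at hnf
            split_ifs with h1
            · exact h1
            · by_contra h0
              exact hnf ⟨lt_of_le_of_ne (hx k).1 (Ne.symm h0), lt_of_le_of_ne (hx k).2 h1⟩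
          obtain ⟨N, hN⟩ := hint
          rw [e, hN]
          rw [hN] at hTi
          have h1 : (N : ℝ) < (T (σ i) : ℝ) := by linarith [hi'.1]
          have h2 : (N : ℝ) + 1 ≤ (T (σ i) : ℝ) := by exact_mod_cast h1
          have := (ht i).2
          linarith
        · refine le_trans (le_of_eq (Finset.sum_congr rfl fun k hk => ?_)) (hxT s)
          have : k ≠ i := fun h => hs (by simpa [h] using hk)
          simp [this]

/-- A vector of the cube obeying two linear constraints is a convex combination of vectors
obeying them with at most two fractional coordinates. -/
theorem mem_convexHull_of_two_constraints (a : I → Fin 2 → ℝ) (r : Fin 2 → ℝ)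
    (y : I → ℝ) (hy : ∀ i, y i ∈ Set.Icc (0 : ℝ) 1) (hr : ∀ e, ∑ i, a i e * y i ≤ r e) :
    y ∈ convexHull ℝ {x : I → ℝ | (∀ i, x i ∈ Set.Icc (0 : ℝ) 1) ∧
      ((∀ i, y i = 0 → x i = 0) ∧ ∀ e, ∑ i, a i e * x i ≤ r e) ∧ (fracSet x).card ≤ 2} := by
  classical
  refine mem_convexHull_of_moves
    (fun x : I → ℝ => (∀ i, y i = 0 → x i = 0) ∧ ∀ e, ∑ i, a i e * x i ≤ r e)
    (fun x => (fracSet x).card ≤ 2) ?_ y hy ⟨fun i h => h, hr⟩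
  rintro x hx ⟨hx0, hxr⟩ hxf
  -- More than two fractional coordinates against two linear forms: a kernel vector changes neither
  -- sum.
  let f : (fracSet x → ℝ) →ₗ[ℝ] (Fin 2 → ℝ) :=
    LinearMap.pi fun e => ∑ i : fracSet x, a i e • LinearMap.proj i
  have hker : LinearMap.ker f ≠ ⊥ := LinearMap.ker_ne_bot_of_finrank_lt (by
    simpa using hxf)
  obtain ⟨g, hg, hg0⟩ := (Submodule.ne_bot_iff _).mp hker
  have hgf : ∀ e, ∑ i : fracSet x, a i e * g i = 0 := by
    intro e
    have := congrFun (LinearMap.mem_ker.mp hg) e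
    simpa [f, LinearMap.sum_apply] using this
  refine ⟨fun i => if h : i ∈ fracSet x then g ⟨i, h⟩ else 0, fun h => hg0 ?_, fun i hi => ?_,
    fun t _ => ⟨fun i hi => ?_, fun e => ?_⟩⟩
  · funext i
    have := congrFun h i.1
    simpa using this
  · by_contra hc
    simp [hc] at hi
  · have hxi := hx0 i hi
    have : i ∉ fracSet x := by simp [mem_fracSet, hxi]
    simp [this, hxi]
  · have e0 : ∑ i, a i e * (if h : i ∈ fracSet x then g ⟨i, h⟩ else 0) = 0 := by
      refine Eq.trans ?_ (hgf e)
      rw [← Finset.sum_subset (Finset.subset_univ (fracSet x)) (fun i _ hi => by simp [hi]),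
        ← Finset.sum_coe_sort (fracSet x)]
      simp
    calc ∑ i, a i e * (x i + t * (if h : i ∈ fracSet x then g ⟨i, h⟩ else 0))
        = ∑ i, a i e * x i + t * ∑ i, a i e * (if h : i ∈ fracSet x then g ⟨i, h⟩ else 0) := by
          rw [Finset.mul_sum, ← Finset.sum_add_distrib]
          exact Finset.sum_congr rfl fun i _ => by ring
      _ ≤ r e := by rw [e0]; simpa using hxr e

end Rounding

/-! ### Fractional packings and the filling of a single bin -/

namespace VBP2

variable {I : Type*} [Fintype I] (P : VBP2 I)

/-- The vector `z` is the coverage of a nonnegative combination of configurations of total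
weight at most `a`. -/
def Pack (z : I → ℝ) (a : ℝ) : Prop :=
  ∃ x : P.Config → ℝ, P.DemandLPFeasible z x ∧ ∑ C, x C ≤ a

variable {P}

theorem OPTf_le_of_pack {z : I → ℝ} {a : ℝ} (h : P.Pack z a) : P.OPTf z ≤ a := by
  obtain ⟨x, hx, ha⟩ := h
  refine le_trans (csInf_le ⟨0, ?_⟩ ⟨x, hx, rfl⟩) ha
  rintro b ⟨x', hx', rfl⟩
  exact Finset.sum_nonneg fun C _ => hx'.1 C

theorem Pack.mono {z : I → ℝ} {a b : ℝ} (h : P.Pack z a) (hab : a ≤ b) : P.Pack z b := by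
  obtain ⟨x, hx, ha⟩ := h
  exact ⟨x, hx, ha.trans hab⟩

theorem pack_zero : P.Pack 0 0 := ⟨0, ⟨fun _ => le_rfl, fun i => by simp⟩, by simp⟩

theorem Pack.add {z z' : I → ℝ} {a b : ℝ} (h : P.Pack z a) (h' : P.Pack z' b) :
    P.Pack (z + z') (a + b) := by
  obtain ⟨x, hx, ha⟩ := h
  obtain ⟨x', hx', ha'⟩ := h'
  refine ⟨x + x', ⟨fun C => add_nonneg (hx.1 C) (hx'.1 C), fun i => ?_⟩, ?_⟩
  · simp only [Pi.add_apply, add_mul, Finset.sum_add_distrib]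
    rw [hx.2 i, hx'.2 i]
  · simp only [Pi.add_apply, Finset.sum_add_distrib]
    linarith

theorem Pack.smul {z : I → ℝ} {a c : ℝ} (h : P.Pack z a) (hc : 0 ≤ c) :
    P.Pack (c • z) (c * a) := by
  obtain ⟨x, hx, ha⟩ := h
  refine ⟨c • x, ⟨fun C => mul_nonneg hc (hx.1 C), fun i => ?_⟩, ?_⟩
  · simp only [Pi.smul_apply, smul_eq_mul, mul_assoc, ← Finset.mul_sum]
    rw [hx.2 i]
  · simp only [Pi.smul_apply, smul_eq_mul, ← Finset.mul_sum]
    exact mul_le_mul_of_nonneg_left ha hc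

theorem Pack.sum {κ : Type*} (s : Finset κ) {z : κ → I → ℝ} {a : κ → ℝ}
    (h : ∀ k ∈ s, P.Pack (z k) (a k)) : P.Pack (∑ k ∈ s, z k) (∑ k ∈ s, a k) := by
  classical
  induction s using Finset.induction_on with
  | empty => simpa using pack_zero
  | insert k s hk ih =>
    rw [Finset.sum_insert hk, Finset.sum_insert hk]
    exact (h k (Finset.mem_insert_self _ _)).add
      (ih fun j hj => h j (Finset.mem_insert_of_mem hj))

theorem pack_config {A : Finset I} (hA : ∀ d, ∑ i ∈ A, P.v i d ≤ 1) :
    P.Pack (finInd A) 1 := by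
  classical
  obtain ⟨D, hD⟩ : ∃ D : P.Config, D.1 = A := ⟨⟨A, hA⟩, rfl⟩
  refine ⟨fun C => if C = D then 1 else 0, ⟨fun C => ?_, fun i => ?_⟩, ?_⟩
  · dsimp only
    split_ifs <;> simp
  · simp only [ite_mul, one_mul, zero_mul, Finset.sum_ite_eq', Finset.mem_univ, if_true, finInd, hD]
  · simp

theorem convex_pack (a : ℝ) : Convex ℝ {z : I → ℝ | P.Pack z a} := by
  intro x hx y hy s t hs ht hst
  have := (Pack.smul hx hs).add (Pack.smul hy ht)
  refine this.mono (le_of_eq ?_)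
  rw [← add_mul, hst, one_mul]

/-- The bridge from rounding to packing: it is enough to pack the near-integral points of which a
vector is a convex combination. -/
theorem pack_of_mem_convexHull {s : Set (I → ℝ)} {a : ℝ} (hs : ∀ z ∈ s, P.Pack z a)
    {z : I → ℝ} (hz : z ∈ convexHull ℝ s) : P.Pack z a :=
  convexHull_min hs (convex_pack a) hz

/-- A nonnegative vector can be packed with one item per configuration. -/
theorem pack_singles {z : I → ℝ} (hz : ∀ i, 0 ≤ z i) : P.Pack z (∑ i, z i) := by
  classical
  have h := Pack.sum (P := P) Finset.univ (z := fun i => z i • finInd {i})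
    (a := fun i => z i * 1)
    (fun i _ => (pack_config (by simpa using P.v_le_one i)).smul (hz i))
  simp only [mul_one] at h
  convert h using 1
  funext j
  simp [finInd, Finset.sum_apply]

/-- Items of volume at most `1/n` can be packed fractionally with `n` items per configuration. -/
theorem pack_small {n : ℕ} (hn : 0 < n) {z : I → ℝ} (hz : ∀ i, z i ∈ Set.Icc (0 : ℝ) 1)
    (hs : ∀ i, 0 < z i → ∀ d, P.v i d ≤ (n : ℝ)⁻¹) {M : ℝ} (hM : ∑ i, z i ≤ M) :
    P.Pack z ((n : ℝ)⁻¹ * M + 1) := by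
  classical
  have hn' : (0 : ℝ) < n := by exact_mod_cast hn
  have hM0 : 0 ≤ M := le_trans (Finset.sum_nonneg fun i _ => (hz i).1) hM
  -- Scaling by N brings the total mass down to at most n. The summand 1 makes N at least 1, which
  -- keeps the scaled vector in the cube.
  set N : ℝ := (n : ℝ)⁻¹ * M + 1 with hN
  have hN1 : 1 ≤ N := by have : 0 ≤ (n : ℝ)⁻¹ * M := by positivity
                         linarith
  have hN0 : 0 < N := by linarith
  have hy : ∀ i, z i / N ∈ Set.Icc (0 : ℝ) 1 := fun i =>
    ⟨div_nonneg (hz i).1 hN0.le, by rw [div_le_one hN0]; linarith [(hz i).2]⟩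
  have hmem := mem_convexHull_of_class_bounds (fun _ : I => ()) (fun _ => n)
    (fun i => z i / N) hy (fun s => by
      simp only [Finset.filter_true]
      rw [← Finset.sum_div, div_le_iff₀ hN0, hN, mul_add, ← mul_assoc,
        mul_inv_cancel₀ hn'.ne', one_mul]
      linarith)
  have h1 : P.Pack (fun i => z i / N) 1 := by
    refine pack_of_mem_convexHull ?_ hmem
    rintro x ⟨A, rfl, hA, hc⟩
    refine pack_config fun d => ?_
    have hcard : (A.card : ℝ) ≤ n := by
      have := hc ()
      simp only [Finset.filter_true] at this
      exact_mod_cast this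
    calc ∑ i ∈ A, P.v i d ≤ ∑ i ∈ A, (n : ℝ)⁻¹ := Finset.sum_le_sum fun i hi => by
          refine hs i ?_ d
          have := hA i hi
          rcases (hz i).1.lt_or_eq with h | h
          · exact h
          · rw [← h] at this; simp at this
      _ = A.card * (n : ℝ)⁻¹ := by simp
      _ ≤ n * (n : ℝ)⁻¹ := by gcongr
      _ = 1 := mul_inv_cancel₀ hn'.ne'
  have h2 := h1.smul hN0.le
  rw [mul_one] at h2
  convert h2 using 1
  funext i
  simp only [Pi.smul_apply, smul_eq_mul]
  field_simp

/-- A vector on a set of items which obeys the volume bounds `r` is, up to a leftover of mass at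
most `2`, a convex combination of sets which obey these bounds. -/
theorem exists_leftover (r : Fin 2 → ℝ) (y : I → ℝ) (hy : ∀ i, y i ∈ Set.Icc (0 : ℝ) 1)
    (hr : ∀ e, ∑ i, P.v i e * y i ≤ r e) :
    ∃ f : I → ℝ, (∀ i, 0 ≤ f i) ∧ (∀ i, f i ≤ y i) ∧ ∑ i, f i ≤ 2 ∧
      y - f ∈ convexHull ℝ {x : I → ℝ | ∃ A : Finset I, x = finInd A ∧ (∀ i ∈ A, y i ≠ 0) ∧
        ∀ e, ∑ i ∈ A, P.v i e ≤ r e} := by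
  classical
  set X : Set (I → ℝ) := {x : I → ℝ | ∃ A : Finset I, x = finInd A ∧ (∀ i ∈ A, y i ≠ 0) ∧
        ∀ e, ∑ i ∈ A, P.v i e ≤ r e} with hX
  -- Vectors admitting such a leftover form a convex set, so only points with at most two fractional
  -- coordinates need checking; there the leftover is the fractional part.
  set Z : Set (I → ℝ) := {x | ∃ f : I → ℝ, (∀ i, 0 ≤ f i) ∧ (∀ i, f i ≤ x i) ∧ ∑ i, f i ≤ 2 ∧
      x - f ∈ convexHull ℝ X} with hZ
  have hconv : Convex ℝ Z := by
    rintro x ⟨f, hf0, hfx, hf2, hf⟩ x' ⟨f', hf0', hfx', hf2', hf'⟩ s t hs ht hst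
    refine ⟨s • f + t • f', fun i => ?_, fun i => ?_, ?_, ?_⟩
    · exact add_nonneg (mul_nonneg hs (hf0 i)) (mul_nonneg ht (hf0' i))
    · exact add_le_add (mul_le_mul_of_nonneg_left (hfx i) hs)
        (mul_le_mul_of_nonneg_left (hfx' i) ht)
    · simp only [Pi.add_apply, Pi.smul_apply, smul_eq_mul, Finset.sum_add_distrib,
        ← Finset.mul_sum]
      nlinarith
    · have := convex_convexHull ℝ X hf hf' hs ht hst
      convert this using 1
      simp only [smul_sub]
      abel
  refine convexHull_min ?_ hconv (mem_convexHull_of_two_constraints (fun i e => P.v i e) r y hy hr)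
  rintro x ⟨hx, ⟨hx0, hxr⟩, hxf⟩
  refine ⟨fun i => if i ∈ fracSet x then x i else 0, fun i => ?_, fun i => ?_, ?_, ?_⟩
  · dsimp only
    split_ifs
    · exact (hx i).1
    · exact le_rfl
  · dsimp only
    split_ifs
    · exact le_rfl
    · exact (hx i).1
  · rw [Finset.sum_ite_mem, Finset.univ_inter]
    calc ∑ i ∈ fracSet x, x i ≤ ∑ i ∈ fracSet x, (1 : ℝ) :=
          Finset.sum_le_sum fun i _ => (hx i).2
      _ = (fracSet x).card := by simp
      _ ≤ 2 := by exact_mod_cast hxf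
  · refine subset_convexHull ℝ _ ⟨({i | x i = 1} : Finset I), ?_, ?_, fun e => ?_⟩
    · funext i
      simp only [Pi.sub_apply, finInd, Finset.mem_filter, Finset.mem_univ, true_and, mem_fracSet]
      have := hx i
      by_cases h1 : x i = 1
      · simp [h1]
      · by_cases h0 : x i = 0
        · simp [h0]
        · have a1 := lt_of_le_of_ne this.1 (Ne.symm h0)
          have a2 := lt_of_le_of_ne this.2 h1
          simp [h1, a1, a2]
    · intro i hi h0
      have := hx0 i h0
      simp [this] at hi
    · refine le_trans ?_ (hxr e)
      rw [Finset.sum_filter]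
      refine Finset.sum_le_sum fun i _ => ?_
      split_ifs with h
      · simp [h]
      · exact mul_nonneg (P.v_nonneg i e) (hx i).1

/-- A convex combination of sets of items outside the support of `y`, together with the vector
`y` filling the remaining volume, fits into one configuration up to a leftover of mass at
most `2`. -/
theorem exists_pack_bin (r : Fin 2 → ℝ) (y : I → ℝ) (hy : ∀ i, y i ∈ Set.Icc (0 : ℝ) 1)
    (hr : ∀ e, ∑ i, P.v i e * y i ≤ r e) (X : Set (Finset I))
    (hX : ∀ A ∈ X, (∀ i ∈ A, y i = 0) ∧ ∀ e, ∑ i ∈ A, P.v i e ≤ 1 - r e)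
    (x : I → ℝ) (hx : x ∈ convexHull ℝ (finInd '' X)) :
    ∃ f : I → ℝ, (∀ i, 0 ≤ f i) ∧ (∀ i, f i ≤ y i) ∧ ∑ i, f i ≤ 2 ∧ P.Pack (x + y - f) 1 := by
  classical
  obtain ⟨f, hf0, hfy, hf2, hf⟩ := exists_leftover (P := P) r y hy hr
  refine ⟨f, hf0, hfy, hf2, ?_⟩
  -- The hull of a Minkowski sum is the sum of the hulls, so each pair of a set from `X` and a
  -- filling set may be packed together; they are disjoint because the sets from `X` avoid the
  -- support of y.
  have hsum := Set.add_mem_add hx hf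
  rw [← convexHull_add] at hsum
  rw [add_sub_assoc]
  refine pack_of_mem_convexHull ?_ hsum
  rintro _ ⟨_, ⟨A, hA, rfl⟩, _, ⟨B, rfl, hB, hBr⟩, rfl⟩
  obtain ⟨hA0, hAr⟩ := hX A hA
  have hdisj : Disjoint A B := Finset.disjoint_left.mpr fun i hi hi' => hB i hi' (hA0 i hi)
  have e : finInd A + finInd B = finInd (A ∪ B) := by
    funext i
    simp only [Pi.add_apply, finInd, Finset.mem_union]
    by_cases h1 : i ∈ A
    · simp [h1, Finset.disjoint_left.mp hdisj h1]
    · simp [h1]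
  change P.Pack (finInd A + finInd B) 1
  rw [e]
  refine pack_config fun d => ?_
  rw [Finset.sum_union hdisj]
  linarith [hAr d, hBr d]

end VBP2

/-! ### Stripes of equal weight -/

/-- A weighted set with a linear order can be cut into `Q` consecutive stripes, each of which
has, up to an error of `1`, the same weight. -/
theorem exists_stripes {I α : Type*} [LinearOrder α] (key : I → α) (hkey : key.Injective)
    (B : Finset I) (w : I → ℝ) (hw : ∀ i, w i ∈ Set.Icc (0 : ℝ) 1) {Q : ℕ} (hQ : 0 < Q) :
    ∃ q : I → ℕ, (∀ i, q i < Q) ∧ (∀ i j, key i ≤ key j → q i ≤ q j) ∧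
      ∀ k < Q, (∑ i ∈ B, w i) / Q - 1 ≤ ∑ i ∈ B with q i = k, w i ∧
        ∑ i ∈ B with q i = k, w i ≤ (∑ i ∈ B, w i) / Q + 1 := by
  classical
  have hQ' : (0 : ℝ) < Q := by exact_mod_cast hQ
  set W := ∑ i ∈ B, w i with hW
  have hW0 : 0 ≤ W := Finset.sum_nonneg fun i _ => (hw i).1
  rcases hW0.eq_or_lt with h0 | hWpos
  · refine ⟨fun _ => 0, fun _ => hQ, fun _ _ _ => le_rfl, fun k _ => ?_⟩
    rw [← h0]
    have h1 : ∑ i ∈ B with 0 = k, w i ≤ W :=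
      Finset.sum_le_sum_of_subset_of_nonneg (Finset.filter_subset _ _) fun i _ _ => (hw i).1
    have h2 : 0 ≤ ∑ i ∈ B with 0 = k, w i := Finset.sum_nonneg fun i _ => (hw i).1
    rw [zero_div]
    constructor <;> linarith
  set F : I → ℝ := fun i => ∑ j ∈ B with key j < key i, w j with hF
  have hF0 : ∀ i, 0 ≤ F i := fun i => Finset.sum_nonneg fun j _ => (hw j).1
  have hFm : ∀ i j, key i ≤ key j → F i ≤ F j := fun i j hij =>
    Finset.sum_le_sum_of_subset_of_nonneg
      (Finset.monotone_filter_right _ fun k _ hk => lt_of_lt_of_le hk hij) fun k _ _ => (hw k).1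
  -- The stripe is read off the weight `F i` strictly before i. The cap Q - 1 matters only where `F
  -- i` equals the whole weight W.
  set q : I → ℕ := fun i => min ⌊F i * Q / W⌋₊ (Q - 1) with hq
  have hqQ : ∀ i, q i < Q := fun i => lt_of_le_of_lt (min_le_right _ _) (by omega)
  set p : ℕ → ℝ := fun k => ∑ i ∈ B with q i < k, w i with hp
  have hps : ∀ k, p (k + 1) = p k + ∑ i ∈ B with q i = k, w i := by
    intro k
    simp only [hp]
    rw [← Finset.sum_union]
    · refine Finset.sum_congr ?_ fun _ _ => rfl
      ext i
      simp only [Finset.mem_filter, Finset.mem_union]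
      constructor
      · rintro ⟨h1, h2⟩
        rcases Nat.lt_succ_iff_lt_or_eq.mp h2 with h | h
        · exact Or.inl ⟨h1, h⟩
        · exact Or.inr ⟨h1, h⟩
      · rintro (⟨h1, h2⟩ | ⟨h1, h2⟩)
        · exact ⟨h1, by omega⟩
        · exact ⟨h1, by omega⟩
    · refine Finset.disjoint_left.mpr fun i hi hi' => ?_
      simp only [Finset.mem_filter] at hi hi'
      omega
  have hlt : ∀ i k, k < Q → (q i < k ↔ F i < k * W / Q) := by
    intro i k hk
    have e1 : q i < k ↔ ⌊F i * Q / W⌋₊ < k := by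
      simp only [hq, min_lt_iff]
      constructor
      · rintro (h | h)
        · exact h
        · omega
      · exact Or.inl
    rw [e1, Nat.floor_lt (div_nonneg (mul_nonneg (hF0 i) hQ'.le) hW0), div_lt_iff₀ hWpos,
      lt_div_iff₀ hQ']
  -- The first k stripes consist of the items starting before kW/Q, so their weight overshoots kW/Q
  -- by at most the last item; consecutive differences give the error 1.
  have hpb : ∀ k ≤ Q, k * W / Q ≤ p k ∧ p k ≤ k * W / Q + 1 := by
    intro k hk
    rcases hk.eq_or_lt with rfl | hk
    · have : p k = W := by
        simp only [hp, hW]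
        rw [Finset.filter_true_of_mem fun i _ => hqQ i]
      rw [this, mul_div_cancel_left₀ _ hQ'.ne']
      constructor <;> linarith
    have hpk : p k = ∑ i ∈ B with F i < k * W / Q, w i := by
      simp only [hp, hlt _ k hk]
    have hkW : (k : ℝ) * W / Q ≤ W := by
      rw [div_le_iff₀ hQ', mul_comm]
      exact mul_le_mul_of_nonneg_left (by exact_mod_cast hk.le) hW0
    rw [hpk]
    constructor
    · by_cases hall : (B.filter fun i => ¬ F i < k * W / Q).Nonempty
      · obtain ⟨j, hj, hmin⟩ := Finset.exists_min_image _ key hall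
        have hj' := (Finset.mem_filter.mp hj).2
        refine (not_lt.mp hj').trans ?_
        refine Finset.sum_le_sum_of_subset_of_nonneg (fun i hi => ?_) fun i _ _ => (hw i).1
        simp only [Finset.mem_filter] at hi ⊢
        refine ⟨hi.1, ?_⟩
        by_contra hc
        have := hmin i (Finset.mem_filter.mpr ⟨hi.1, hc⟩)
        exact absurd hi.2 (not_lt.mpr this)
      · have hf : ∀ i ∈ B, F i < k * W / Q := by
          intro i hi
          by_contra hc
          exact hall ⟨i, Finset.mem_filter.mpr ⟨hi, hc⟩⟩
        rw [Finset.filter_true_of_mem hf]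
        exact hkW
    · by_cases hne : (B.filter fun i => F i < k * W / Q).Nonempty
      · obtain ⟨l, hl, hmax⟩ := Finset.exists_max_image _ key hne
        have hl' := (Finset.mem_filter.mp hl)
        have hsub : (B.filter fun i => F i < k * W / Q) ⊆
            insert l (B.filter fun i => key i < key l) := by
          intro i hi
          have h1 := hmax i hi
          rcases h1.eq_or_lt with h | h
          · exact Finset.mem_insert.mpr (Or.inl (hkey h))
          · exact Finset.mem_insert_of_mem
              (Finset.mem_filter.mpr ⟨(Finset.mem_filter.mp hi).1, h⟩)
        have h2 := Finset.sum_le_sum_of_subset_of_nonneg (f := w) hsub fun i _ _ => (hw i).1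
        rw [Finset.sum_insert (by simp)] at h2
        have h3 : F l = ∑ i ∈ B with key i < key l, w i := rfl
        rw [← h3] at h2
        linarith [(hw l).2, hl'.2]
      · rw [Finset.not_nonempty_iff_eq_empty.mp hne, Finset.sum_empty]
        positivity
  refine ⟨q, hqQ, fun i j hij => ?_, fun k hk => ?_⟩
  · refine min_le_min_right _ (Nat.floor_le_floor ?_)
    have := hFm i j hij
    gcongr
  · have h1 := hpb k hk.le
    have h2 := hpb (k + 1) hk
    have h3 := hps k
    have e : ((k + 1 : ℕ) : ℝ) * W / Q = k * W / Q + W / Q := by push_cast; ring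
    rw [e] at h2
    constructor <;> linarith [h1.1, h1.2, h2.1, h2.2]

/-! ### Boxes and rectangles of large items -/

namespace VBP2

variable {I : Type*} (P : VBP2 I)

/-- The box of an item: its volume vector rounded down to multiples of `1/(4n^2)`. -/
noncomputable def box (n : ℕ) (i : I) (e : Fin 2) : Fin (4 * n ^ 2 + 1) :=
  ⟨⌊P.v i e * (4 * n ^ 2 : ℕ)⌋₊, by
    refine Nat.lt_succ_of_le (Nat.floor_le_of_le ?_)
    exact mul_le_of_le_one_left (Nat.cast_nonneg _) (P.v_le_one i e)⟩

theorem v_le_of_box_eq {n : ℕ} (hn : 0 < n) {i j : I} (h : P.box n i = P.box n j) (e : Fin 2) :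
    P.v i e ≤ P.v j e + 1 / (4 * (n : ℝ) ^ 2) := by
  have h1 := congrArg Fin.val (congrFun h e)
  simp only [box] at h1
  have hn' : (0 : ℝ) < 4 * (n : ℝ) ^ 2 := by positivity
  have h2 := Nat.lt_floor_add_one (P.v i e * (4 * n ^ 2 : ℕ))
  have h3 := Nat.floor_le (mul_nonneg (P.v_nonneg j e) (Nat.cast_nonneg (4 * n ^ 2)))
  rw [h1] at h2
  have h4 : P.v i e * (4 * n ^ 2 : ℕ) < P.v j e * (4 * n ^ 2 : ℕ) + 1 := by linarith
  push_cast at h4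
  rw [← sub_le_iff_le_add', le_div_iff₀ hn']
  linarith

variable [Fintype I]

/-- A linear order on the items which refines the order by the volume in dimension `e`. -/
noncomputable def key (e : Fin 2) (i : I) : ℝ ×ₗ Fin (Fintype.card I) :=
  toLex (P.v i e, Fintype.equivFin I i)

/-- Ties in volume are broken by an enumeration. Without this a stripe boundary could fall inside a
group of equal keys and the error would exceed one item. -/
theorem key_injective (e : Fin 2) : Function.Injective (P.key e) := by
  intro i j h
  have := congrArg (fun x => (ofLex x).2) h
  simpa [key] using this

theorem v_le_of_key_le {e : Fin 2} {i j : I} (h : P.key e i ≤ P.key e j) :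
    P.v i e ≤ P.v j e := by
  have h1 := (Prod.Lex.le_iff).mp h
  simp only [key, ofLex_toLex] at h1
  rcases h1 with h1 | h1
  · exact h1.le
  · exact h1.1.le

open Classical in
/-- The large items of the box `B` which lie, in the order of each dimension `e`, between the
items `a e` and `b e`. -/
noncomputable def rectangle (δ : ℝ) (n : ℕ) (B : Fin 2 → Fin (4 * n ^ 2 + 1))
    (a b : Fin 2 → P.large δ) : Finset I :=
  {i ∈ P.large δ | P.box n i = B ∧
    ∀ e, P.key e (a e) ≤ P.key e i ∧ P.key e i ≤ P.key e (b e)}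

open Classical in
/-- The indicator vectors of all rectangles of large items. -/
noncomputable def rectangles (δ : ℝ) (n : ℕ) : Finset (I → ℝ) :=
  Finset.univ.image fun x : (Fin 2 → Fin (4 * n ^ 2 + 1)) ×
    (Fin 2 → P.large δ) × (Fin 2 → P.large δ) => finInd (P.rectangle δ n x.1 x.2.1 x.2.2)

theorem rectangles_nonneg {δ : ℝ} {n : ℕ} {u : I → ℝ} (hu : u ∈ P.rectangles δ n) (i : I) :
    0 ≤ u i := by
  simp only [rectangles, Finset.mem_image] at hu
  obtain ⟨x, -, rfl⟩ := hu
  unfold finInd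
  split_ifs <;> simp

/-- A rectangle is named by its box and by a lower and an upper large item in each of two orders;
this is the source of the fourth power. -/
theorem card_rectangles_le (δ : ℝ) (n : ℕ) :
    (P.rectangles δ n).card ≤ (4 * n ^ 2 + 1) ^ 2 * (P.large δ).card ^ 4 := by
  refine Finset.card_image_le.trans (le_of_eq ?_)
  rw [Finset.card_univ]
  simp only [Fintype.card_prod, Fintype.card_fun, Fintype.card_fin, Fintype.card_coe]
  ring

open Classical in
/-- The large items of a box lying in given stripes of both orders form a rectangle. -/
theorem finInd_mem_rectangles {δ : ℝ} {n : ℕ} (B : Fin 2 → Fin (4 * n ^ 2 + 1))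
    (q : Fin 2 → I → ℕ)
    (hq : ∀ e, ∀ i j, P.box n i = P.box n j → P.key e i ≤ P.key e j → q e i ≤ q e j)
    (k : Fin 2 → ℕ)
    (hne : ({i ∈ P.large δ | P.box n i = B ∧ ∀ e, q e i = k e} : Finset I).Nonempty) :
    finInd {i ∈ P.large δ | P.box n i = B ∧ ∀ e, q e i = k e} ∈ P.rectangles δ n := by
  -- The bounds are the extreme items of the whole stripe of order e in the box. As `q e` is
  -- monotone within a box, anything between them lies in the same stripe.
  have hne' : ∀ e, ({i ∈ P.large δ | P.box n i = B ∧ q e i = k e} : Finset I).Nonempty := by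
    intro e
    obtain ⟨i, hi⟩ := hne
    simp only [Finset.mem_filter] at hi
    exact ⟨i, by simp only [Finset.mem_filter]; exact ⟨hi.1, hi.2.1, hi.2.2 e⟩⟩
  choose a ha hamin using fun e => Finset.exists_min_image _ (P.key e) (hne' e)
  choose b hb hbmax using fun e => Finset.exists_max_image _ (P.key e) (hne' e)
  have ha' := fun e => Finset.mem_filter.mp (ha e)
  have hb' := fun e => Finset.mem_filter.mp (hb e)
  refine Finset.mem_image.mpr
    ⟨⟨B, fun e => ⟨a e, (ha' e).1⟩, fun e => ⟨b e, (hb' e).1⟩⟩, Finset.mem_univ _, ?_⟩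
  congr 1
  ext i
  simp only [rectangle, Finset.mem_filter]
  constructor
  · rintro ⟨hL, hB, hi⟩
    refine ⟨hL, hB, fun e => le_antisymm ?_ ?_⟩
    · rw [← (hb' e).2.2]
      exact hq e _ _ (hB.trans (hb' e).2.1.symm) (hi e).2
    · rw [← (ha' e).2.2]
      exact hq e _ _ ((ha' e).2.1.trans hB.symm) (hi e).1
  · rintro ⟨hL, hB, hi⟩
    exact ⟨hL, hB, fun e => ⟨hamin e i (Finset.mem_filter.mpr ⟨hL, hB, hi e⟩),
      hbmax e i (Finset.mem_filter.mpr ⟨hL, hB, hi e⟩)⟩⟩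

end VBP2

/-! ### Distributing demand to slots and packing families of bins -/

/-- Fractional items with demand at most `∑ N t * T t s + err s` on each slot `s` can be
distributed to the slots of bins of types `t`, up to a rest of mass at most `∑ err s`. -/
theorem exists_distribution {I ι τ : Type*} [Fintype I] [Fintype ι] [DecidableEq ι]
    (act : Finset τ) (N : τ → ℝ) (hN : ∀ t ∈ act, 1 ≤ N t) (T : τ → ι → ℕ) (hi : I → ι)
    (z : I → ℝ) (hz : ∀ i, z i ∈ Set.Icc (0 : ℝ) 1) (err : ι → ℝ) (herr : ∀ s, 0 ≤ err s)
    (hdem : ∀ s, ∑ i with hi i = s, z i ≤ ∑ t ∈ act, N t * T t s + err s) :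
    ∃ (x : τ → I → ℝ) (g : I → ℝ), (∀ i, 0 ≤ g i) ∧ ∑ i, g i ≤ ∑ s, err s ∧
      (∀ i, z i = ∑ t ∈ act, N t * x t i + g i) ∧
      ∀ t ∈ act, x t ∈ convexHull ℝ (finInd '' {A : Finset I | (∀ i ∈ A, 0 < z i) ∧
        ∀ s, (A.filter fun i => hi i = s).card ≤ T t s}) := by
  classical
  set S : ι → ℝ := fun s => ∑ t ∈ act, N t * T t s with hS
  have hNT : ∀ t ∈ act, ∀ s, 0 ≤ N t * (T t s : ℝ) := fun t ht s =>
    mul_nonneg (by linarith [hN t ht]) (Nat.cast_nonneg _)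
  have hS0 : ∀ s, 0 ≤ S s := fun s => Finset.sum_nonneg fun t ht => hNT t ht s
  have hST : ∀ t ∈ act, ∀ s, (T t s : ℝ) ≤ S s := fun t ht s => by
    refine le_trans ?_ (Finset.single_le_sum (f := fun t => N t * (T t s : ℝ))
      (fun t ht => hNT t ht s) ht)
    exact le_mul_of_one_le_left (Nat.cast_nonneg _) (hN t ht)
  set Z : ι → ℝ := fun s => ∑ i with hi i = s, z i with hZ
  -- `α s` is the fraction of the demand on slot s that the supply `S s` can carry; the remainder is
  -- within `err s`.
  have hα : ∀ s, ∃ α : ℝ, 0 ≤ α ∧ α ≤ 1 ∧ α * Z s ≤ S s ∧ (1 - α) * Z s ≤ err s := by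
    intro s
    rcases le_or_gt (Z s) (S s) with h | h
    · exact ⟨1, zero_le_one, le_rfl, by simpa using h, by simpa using herr s⟩
    · have hZ0 : 0 < Z s := lt_of_le_of_lt (hS0 s) h
      refine ⟨S s / Z s, div_nonneg (hS0 s) hZ0.le, (div_le_one hZ0).mpr h.le, ?_, ?_⟩
      · rw [div_mul_cancel₀ _ hZ0.ne']
      · rw [sub_mul, one_mul, div_mul_cancel₀ _ hZ0.ne']
        linarith [hdem s]
  choose α hα0 hα1 hαS hαe using hα
  have hm0 : ∀ i, 0 ≤ α (hi i) * z i := fun i => mul_nonneg (hα0 _) (hz i).1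
  have hm1 : ∀ i, α (hi i) * z i ≤ 1 := fun i => mul_le_one₀ (hα1 _) (hz i).1 (hz i).2
  have hzero : ∀ i, S (hi i) = 0 → α (hi i) * z i = 0 := by
    intro i h
    have h1 := hαS (hi i)
    rw [h, hZ, Finset.mul_sum] at h1
    have h2 : α (hi i) * z i ≤ ∑ j with hi j = hi i, α (hi i) * z j :=
      Finset.single_le_sum (f := fun j => α (hi i) * z j)
        (fun j _ => mul_nonneg (hα0 _) (hz j).1) (by simp)
    linarith [hm0 i]
  -- A bin of type t gets the share T t s / S s of the carried demand. Entries are at most 1 because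
  -- `N t ≥ 1` gives T t s ≤ S s; if S s = 0, nothing is carried and the quotient is 0.
  refine ⟨fun t i => T t (hi i) * (α (hi i) * z i) / S (hi i), fun i => (1 - α (hi i)) * z i,
    fun i => mul_nonneg (by linarith [hα1 (hi i)]) (hz i).1, ?_, fun i => ?_, fun t ht => ?_⟩
  · rw [← Finset.sum_fiberwise Finset.univ hi]
    refine Finset.sum_le_sum fun s _ => le_trans (le_of_eq ?_) (hαe s)
    rw [hZ, Finset.mul_sum]
    refine Finset.sum_congr rfl fun i hi' => ?_
    rw [(Finset.mem_filter.mp hi').2]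
  · have : ∑ t ∈ act, N t * (T t (hi i) * (α (hi i) * z i) / S (hi i)) = α (hi i) * z i := by
      by_cases h : S (hi i) = 0
      · simp [hzero i h]
      · have e : ∀ t, N t * (T t (hi i) * (α (hi i) * z i) / S (hi i))
            = N t * T t (hi i) * ((α (hi i) * z i) / S (hi i)) := fun t => by ring
        simp_rw [e]
        rw [← Finset.sum_mul]
        change S (hi i) * _ = _
        field_simp
    rw [this]
    ring
  · have key := mem_convexHull_of_class_bounds hi (T t)
      (fun i => T t (hi i) * (α (hi i) * z i) / S (hi i)) (fun i => ⟨?_, ?_⟩) fun s => ?_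
    · refine convexHull_mono ?_ key
      rintro _ ⟨A, rfl, hA, hc⟩
      refine ⟨A, ⟨fun i hiA => ?_, hc⟩, rfl⟩
      refine lt_of_le_of_ne (hz i).1 fun h => ?_
      have := hA i hiA
      simp [← h] at this
    · exact div_nonneg (mul_nonneg (Nat.cast_nonneg _) (hm0 i)) (hS0 _)
    · refine div_le_one_of_le₀ ?_ (hS0 _)
      exact (mul_le_of_le_one_right (Nat.cast_nonneg _) (hm1 i)).trans (hST t ht _)
    · have e : ∑ i with hi i = s, T t (hi i) * (α (hi i) * z i) / S (hi i)
          = T t s * (α s * Z s) / S s := by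
        rw [hZ, Finset.mul_sum, Finset.mul_sum, Finset.sum_div]
        refine Finset.sum_congr rfl fun i hi' => ?_
        rw [(Finset.mem_filter.mp hi').2]
      rw [e]
      rcases (hS0 s).eq_or_lt with h | h
      · rw [← h]
        simp
      · rw [div_le_iff₀ h]
        exact mul_le_mul_of_nonneg_left (hαS s) (Nat.cast_nonneg _)

namespace VBP2

variable {I : Type*} [Fintype I] {P : VBP2 I}

/-- Packing a weighted family of bins, each of which contains a convex combination of sets and a
fractional filling by small items. -/
theorem pack_bins {n : ℕ} (hn : 0 < n) {τ : Type*} (act : Finset τ) (N : τ → ℝ)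
    (hN : ∀ t ∈ act, 0 ≤ N t) (r : τ → Fin 2 → ℝ) (x y : τ → I → ℝ) (X : τ → Set (Finset I))
    (hX : ∀ t ∈ act, ∀ A ∈ X t, (∀ i ∈ A, y t i = 0) ∧ ∀ e, ∑ i ∈ A, P.v i e ≤ 1 - r t e)
    (hx : ∀ t ∈ act, x t ∈ convexHull ℝ (finInd '' X t))
    (hy : ∀ t ∈ act, ∀ i, y t i ∈ Set.Icc (0 : ℝ) 1)
    (hr : ∀ t ∈ act, ∀ e, ∑ i, P.v i e * y t i ≤ r t e)
    (hs : ∀ t ∈ act, ∀ i, 0 < y t i → ∀ e, P.v i e ≤ (n : ℝ)⁻¹)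
    (hY : ∀ i, ∑ t ∈ act, N t * y t i ≤ 1) :
    P.Pack (∑ t ∈ act, N t • (x t + y t))
      (∑ t ∈ act, N t + ((n : ℝ)⁻¹ * (2 * ∑ t ∈ act, N t) + 1)) := by
  classical
  have hex : ∀ t, ∃ f : I → ℝ, t ∈ act → (∀ i, 0 ≤ f i) ∧ (∀ i, f i ≤ y t i) ∧ ∑ i, f i ≤ 2 ∧
      P.Pack (x t + y t - f) 1 := by
    intro t
    by_cases ht : t ∈ act
    · obtain ⟨f, hf⟩ := exists_pack_bin (r t) (y t) (hy t ht) (hr t ht) (X t) (hX t ht) (x t)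
        (hx t ht)
      exact ⟨f, fun _ => hf⟩
    · exact ⟨0, fun h => absurd h ht⟩
  choose f hf using hex
  have h1 : P.Pack (∑ t ∈ act, N t • (x t + y t - f t)) (∑ t ∈ act, N t * 1) :=
    Pack.sum act fun t ht => ((hf t ht).2.2.2).smul (hN t ht)
  have happ : ∀ i, (∑ t ∈ act, N t • f t) i = ∑ t ∈ act, N t * f t i := fun i => by
    simp [Finset.sum_apply]
  have hF0 : ∀ i, 0 ≤ ∑ t ∈ act, N t * f t i := fun i =>
    Finset.sum_nonneg fun t ht => mul_nonneg (hN t ht) ((hf t ht).1 i)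
  -- The leftovers of all bins form one vector of small items in the cube, of mass at most 2 per
  -- bin.
  have h2 : P.Pack (∑ t ∈ act, N t • f t) ((n : ℝ)⁻¹ * (2 * ∑ t ∈ act, N t) + 1) := by
    refine pack_small hn (fun i => ?_) (fun i hi e => ?_) ?_
    · rw [happ]
      exact ⟨hF0 i, (Finset.sum_le_sum fun t ht =>
        mul_le_mul_of_nonneg_left ((hf t ht).2.1 i) (hN t ht)).trans (hY i)⟩
    · rw [happ] at hi
      obtain ⟨t, ht, hpos⟩ := Finset.exists_lt_of_sum_lt
        (f := fun _ => (0 : ℝ)) (by simpa using hi)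
      refine hs t ht i ?_ e
      by_contra hc
      have h3 : f t i = 0 := le_antisymm (((hf t ht).2.1 i).trans (not_lt.mp hc)) ((hf t ht).1 i)
      simp [h3] at hpos
    · simp_rw [happ]
      rw [Finset.sum_comm, Finset.mul_sum]
      refine Finset.sum_le_sum fun t ht => ?_
      rw [← Finset.mul_sum, mul_comm]
      exact mul_le_mul_of_nonneg_right (hf t ht).2.2.1 (hN t ht)
  have h3 := h1.add h2
  rw [← Finset.sum_add_distrib] at h3
  simp only [← smul_add, sub_add_cancel, mul_one] at h3
  exact h3

end VBP2

/-! ### Coverage and norm of summable weights, and their decomposition -/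

namespace VBP2

theorem tol_le {I : Type*} {P : VBP2 I} {u : I → ℝ} {b : ℝ} (h : ∀ C : P.Config, ∑ i ∈ C.1, u i ≤ b) : P.tol u ≤ b :=
  ciSup_le h

variable {I : Type*} [Fintype I] {P : VBP2 I}

/-- A nonnegative summable vector with a convergent coverage. -/
structure IsSummableWeight (lam : P.MultiConfig → ℝ) : Prop where
  nonneg : ∀ C, 0 ≤ lam C
  summable : Summable lam
  summable_coverage : ∀ i, Summable fun C : P.MultiConfig => lam C * (C.1 i : ℝ)

theorem IsFractional.isSummableWeight {lam : P.MultiConfig → ℝ} (h : P.IsFractional lam) :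
    IsSummableWeight lam :=
  ⟨fun C => (h.mem C).1, h.summable_self, h.summable⟩

open Classical in
/-- The restriction of `lam` to the multi-configurations `C` with `f C = t`. -/
noncomputable def part {τ : Type*} (f : P.MultiConfig → τ) (lam : P.MultiConfig → ℝ) (t : τ)
    (C : P.MultiConfig) : ℝ := if f C = t then lam C else 0

section part

variable {τ : Type*} {f : P.MultiConfig → τ} {lam : P.MultiConfig → ℝ}

theorem part_nonneg (h : ∀ C, 0 ≤ lam C) (t : τ) (C : P.MultiConfig) : 0 ≤ part f lam t C := by
  unfold part
  split_ifs
  · exact h C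
  · exact le_rfl

theorem part_le (h : ∀ C, 0 ≤ lam C) (t : τ) (C : P.MultiConfig) : part f lam t C ≤ lam C := by
  unfold part
  split_ifs
  · exact le_rfl
  · exact h C

theorem of_part_pos {t : τ} {C : P.MultiConfig} (h : 0 < part f lam t C) :
    f C = t ∧ 0 < lam C := by
  unfold part at h
  split_ifs at h with hc
  · exact ⟨hc, h⟩
  · exact absurd h (lt_irrefl _)

theorem IsSummableWeight.part (h : IsSummableWeight lam) (t : τ) :
    IsSummableWeight (part f lam t) where
  nonneg := part_nonneg h.nonneg t
  summable := Summable.of_nonneg_of_le (part_nonneg h.nonneg t) (part_le h.nonneg t) h.summable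
  summable_coverage i := Summable.of_nonneg_of_le
    (fun C => mul_nonneg (part_nonneg h.nonneg t C) (Nat.cast_nonneg _))
    (fun C => mul_le_mul_of_nonneg_right (part_le h.nonneg t C) (Nat.cast_nonneg _))
    (h.summable_coverage i)

theorem sum_norm1_part [Fintype τ] (h : IsSummableWeight lam) :
    ∑ t, P.norm1 (part f lam t) = P.norm1 lam := by
  classical
  unfold norm1
  rw [← Summable.tsum_finsetSum fun t _ => (h.part t).summable]
  refine tsum_congr fun C => ?_
  simp [VBP2.part]

theorem sum_coverage_part [Fintype τ] (h : IsSummableWeight lam) (i : I) :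
    ∑ t, P.coverage (part f lam t) i = P.coverage lam i := by
  classical
  unfold coverage
  rw [← Summable.tsum_finsetSum fun t _ => (h.part t).summable_coverage i]
  refine tsum_congr fun C => ?_
  rw [← Finset.sum_mul]
  simp [VBP2.part]

theorem sum_coverage_part_fiber [Fintype τ] {σ : Type*} [DecidableEq σ] (g : τ → σ)
    (h : IsSummableWeight lam) (s : σ) (i : I) :
    ∑ t with g t = s, P.coverage (part f lam t) i =
      P.coverage (part (fun C => g (f C)) lam s) i := by
  classical
  unfold coverage
  rw [← Summable.tsum_finsetSum fun t _ => (h.part t).summable_coverage i]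
  refine tsum_congr fun C => ?_
  rw [← Finset.sum_mul]
  congr 1
  simp [VBP2.part, Finset.sum_ite_eq]

end part

variable {lam : P.MultiConfig → ℝ}

theorem IsSummableWeight.coverage_nonneg (h : IsSummableWeight lam) (i : I) :
    0 ≤ P.coverage lam i :=
  tsum_nonneg fun C => mul_nonneg (h.nonneg C) (Nat.cast_nonneg _)

theorem IsSummableWeight.norm1_nonneg (h : IsSummableWeight lam) : 0 ≤ P.norm1 lam :=
  tsum_nonneg h.nonneg

/-- Exchanging the finite sum over items with the series over multi-configurations turns a bound for
each member of the support into a bound for the coverage. -/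
theorem IsSummableWeight.sum_mul_coverage_le (h : IsSummableWeight lam) (a : I → ℝ) (b : ℝ)
    (hab : ∀ C, 0 < lam C → ∑ i, a i * (C.1 i : ℝ) ≤ b) :
    ∑ i, a i * P.coverage lam i ≤ b * P.norm1 lam := by
  unfold coverage norm1
  simp_rw [← tsum_mul_left]
  have hs : ∀ i, Summable fun C : P.MultiConfig => a i * (lam C * (C.1 i : ℝ)) := fun i =>
    (h.summable_coverage i).mul_left _
  rw [← Summable.tsum_finsetSum fun i _ => hs i]
  refine Summable.tsum_le_tsum (fun C => ?_) (summable_sum fun i _ => hs i) (h.summable.mul_left _)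
  have e : ∑ i, a i * (lam C * (C.1 i : ℝ)) = (∑ i, a i * (C.1 i : ℝ)) * lam C := by
    rw [Finset.sum_mul]
    exact Finset.sum_congr rfl fun i _ => by ring
  rw [e]
  rcases (h.nonneg C).eq_or_lt with h0 | h0
  · rw [← h0]; simp
  · exact mul_le_mul_of_nonneg_right (hab C h0) h0.le

theorem IsSummableWeight.sum_mul_coverage_eq (h : IsSummableWeight lam) (a : I → ℝ) (b : ℝ)
    (hab : ∀ C, 0 < lam C → ∑ i, a i * (C.1 i : ℝ) = b) :
    ∑ i, a i * P.coverage lam i = b * P.norm1 lam := by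
  refine le_antisymm (h.sum_mul_coverage_le a b fun C hC => (hab C hC).le) ?_
  have := h.sum_mul_coverage_le (fun i => -a i) (-b) fun C hC => by
    simp only [neg_mul, Finset.sum_neg_distrib, hab C hC]
    exact le_rfl
  simp only [neg_mul, Finset.sum_neg_distrib] at this
  linarith

/-- The number of large items in a multi-configuration is at most `2/δ`. -/
theorem sum_large_le {δ : ℝ} (hδ : 0 < δ) (C : P.MultiConfig) :
    ∑ i ∈ P.large δ, (C.1 i : ℝ) ≤ 2 * δ⁻¹ := by
  -- A large item has v₀ + v₁ > δ, whereas these sums total at most 2.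
  have h1 : ∑ i ∈ P.large δ, (C.1 i : ℝ) * δ ≤ ∑ i, (C.1 i : ℝ) * (P.v i 0 + P.v i 1) := by
    refine (Finset.sum_le_sum fun i hi => ?_).trans
      (Finset.sum_le_sum_of_subset_of_nonneg (Finset.subset_univ (P.large δ)) fun i _ _ =>
        mul_nonneg (Nat.cast_nonneg _) (add_nonneg (P.v_nonneg i 0) (P.v_nonneg i 1)))
    refine mul_le_mul_of_nonneg_left ?_ (Nat.cast_nonneg _)
    simp only [large, Finset.mem_filter, Finset.mem_univ, true_and, Fin.exists_fin_two] at hi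
    have a0 := P.v_nonneg i 0
    have a1 := P.v_nonneg i 1
    rcases hi with h | h <;> linarith
  have h2 : ∑ i, (C.1 i : ℝ) * (P.v i 0 + P.v i 1) ≤ 2 := by
    have a0 := C.2 0
    have a1 := C.2 1
    unfold mvol at a0 a1
    simp only [mul_add, Finset.sum_add_distrib]
    linarith
  rw [← Finset.sum_mul] at h1
  rw [← div_eq_mul_inv, le_div_iff₀ hδ]
  linarith

/-- A configuration contains at most `2/δ` large items. -/
theorem card_large_config_le {δ : ℝ} (hδ : 0 < δ) (C : P.Config) (A : Finset I)
    (hA : A ⊆ P.large δ) : ∑ i ∈ C.1, finInd A i ≤ 2 * δ⁻¹ := by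
  classical
  have h1 : ∀ i ∈ C.1, finInd A i * δ ≤ P.v i 0 + P.v i 1 := by
    intro i _
    have a0 := P.v_nonneg i 0
    have a1 := P.v_nonneg i 1
    unfold finInd
    split_ifs with h
    · have hi := hA h
      simp only [large, Finset.mem_filter, Finset.mem_univ, true_and, Fin.exists_fin_two] at hi
      rcases hi with h | h <;> linarith
    · linarith
  have h2 := Finset.sum_le_sum h1
  rw [← Finset.sum_mul, Finset.sum_add_distrib] at h2
  rw [← div_eq_mul_inv, le_div_iff₀ hδ]
  have c0 := C.2 0
  have c1 := C.2 1
  linarith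

end VBP2

/-! ### Flat and steep small items -/

namespace VBP2

variable {I : Type*} [Fintype I] (P : VBP2 I)

open Classical in
/-- The small items whose volume in the dimension `e`, in which only the little space `r e` is
left, is large compared to their volume in the other dimension. -/
noncomputable def steep (δ : ℝ) (n : ℕ) (e : Fin 2) (r : Fin 2 → ℝ) : Finset I :=
  {i | i ∉ P.large δ ∧ r e * n ^ 2 < 1 ∧ r e * n ^ 2 * P.v i (e + 1) < P.v i e}

open Classical in
/-- The small items which are not steep. -/
noncomputable def flat (δ : ℝ) (n : ℕ) (e : Fin 2) (r : Fin 2 → ℝ) : Finset I :=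
  {i | i ∉ P.large δ ∧ i ∉ P.steep δ n e r}

/-- The volume in dimension `d` of the part `w` of the flat items. -/
noncomputable def flatVec (δ : ℝ) (n : ℕ) (e : Fin 2) (r : Fin 2 → ℝ) (w : I → ℝ) (d : Fin 2)
    (i : I) : ℝ := finInd (P.flat δ n e r) i * (w i * P.v i d)

/-- The total volume of the part `w` of the steep items. -/
noncomputable def steepVec (δ : ℝ) (n : ℕ) (e : Fin 2) (r : Fin 2 → ℝ) (w : I → ℝ)
    (i : I) : ℝ := finInd (P.steep δ n e r) i * (w i * (P.v i 0 + P.v i 1))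

variable {P} {δ : ℝ} {n : ℕ} {e : Fin 2} {r : Fin 2 → ℝ} {w : I → ℝ}

theorem finInd_flat_add_steep (i : I) (hi : i ∉ P.large δ) :
    finInd (P.flat δ n e r) i + finInd (P.steep δ n e r) i = 1 := by
  classical
  by_cases h : i ∈ P.steep δ n e r
  · simp [finInd, h, flat]
  · simp [finInd, h, flat, hi]

theorem finInd_flat_of_large {i : I} (hi : i ∈ P.large δ) : finInd (P.flat δ n e r) i = 0 := by
  classical
  simp [finInd, flat, hi]

theorem finInd_steep_of_large {i : I} (hi : i ∈ P.large δ) : finInd (P.steep δ n e r) i = 0 := by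
  classical
  simp [finInd, steep, hi]

theorem flatVec_nonneg (hw : ∀ i, w i ∈ Set.Icc (0 : ℝ) 1) (d : Fin 2) (i : I) :
    0 ≤ P.flatVec δ n e r w d i :=
  mul_nonneg (finInd_nonneg _ _) (mul_nonneg (hw i).1 (P.v_nonneg i d))

theorem steepVec_nonneg (hw : ∀ i, w i ∈ Set.Icc (0 : ℝ) 1) (i : I) :
    0 ≤ P.steepVec δ n e r w i :=
  mul_nonneg (finInd_nonneg _ _) (mul_nonneg (hw i).1 (add_nonneg (P.v_nonneg i 0) (P.v_nonneg i 1)))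

theorem flatVec_le (hw : ∀ i, w i ∈ Set.Icc (0 : ℝ) 1) (d : Fin 2) (i : I) :
    P.flatVec δ n e r w d i ≤ P.v i d := by
  have h1 := P.v_nonneg i d
  have h2 := hw i
  exact (mul_le_of_le_one_left (mul_nonneg h2.1 h1) (finInd_le_one _ _)).trans
    (mul_le_of_le_one_left h1 h2.2)

/-- If r d · n² ≥ 1, the volume bound 1 of a configuration suffices. By `hr'` only d = e can fail
this, and then a flat item has at most r e · n² times its volume in the other dimension, which
totals at most 1. The bound is proportional to r d so that extra bins of the same type can absorb
the error. -/
theorem tol_flatVec_le (hw : ∀ i, w i ∈ Set.Icc (0 : ℝ) 1) (hr : ∀ d, 0 ≤ r d)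
    (hr' : 1 ≤ r (e + 1) * n ^ 2) (d : Fin 2) :
    P.tol (P.flatVec δ n e r w d) ≤ r d * n ^ 2 := by
  classical
  refine tol_le fun C => ?_
  have hle : ∑ i ∈ C.1, P.flatVec δ n e r w d i ≤ 1 :=
    (Finset.sum_le_sum fun i _ => flatVec_le hw d i).trans (C.2 d)
  rcases le_or_gt 1 (r d * n ^ 2) with h | h
  · exact hle.trans h
  have hde : d = e := by
    by_contra hc
    have : ∀ d e : Fin 2, ¬ d = e → d = e + 1 := by decide
    rw [this d e hc] at h
    linarith
  subst hde
  have h0 : 0 ≤ r d * (n : ℝ) ^ 2 := mul_nonneg (hr d) (by positivity)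
  have : ∀ i ∈ C.1, P.flatVec δ n d r w d i ≤ r d * n ^ 2 * P.v i (d + 1) := by
    intro i _
    have h2 : 0 ≤ r d * (n : ℝ) ^ 2 * P.v i (d + 1) := mul_nonneg h0 (P.v_nonneg i _)
    by_cases hi : i ∈ P.flat δ n d r
    · refine (flatVec_le hw d i).trans ?_
      simp only [flat, steep, Finset.mem_filter, Finset.mem_univ, true_and] at hi
      by_contra hc
      exact hi.2 ⟨hi.1, h, not_le.mp hc⟩
    · simpa [flatVec, finInd, hi] using h2
  refine (Finset.sum_le_sum this).trans ?_
  rw [← Finset.mul_sum]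
  exact mul_le_of_le_one_right h0 (C.2 (d + 1))

theorem steepVec_le (hw : ∀ i, w i ∈ Set.Icc (0 : ℝ) 1) (i : I) :
    P.steepVec δ n e r w i ≤ P.v i 0 + P.v i 1 := by
  have h1 := add_nonneg (P.v_nonneg i 0) (P.v_nonneg i 1)
  have h2 := hw i
  exact (mul_le_of_le_one_left (mul_nonneg h2.1 h1) (finInd_le_one _ _)).trans
    (mul_le_of_le_one_left h1 h2.2)

theorem tol_steepVec_le (hw : ∀ i, w i ∈ Set.Icc (0 : ℝ) 1) :
    P.tol (P.steepVec δ n e r w) ≤ 2 := by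
  refine tol_le fun C => (Finset.sum_le_sum fun i _ => steepVec_le hw i).trans ?_
  rw [Finset.sum_add_distrib]
  have h0 := C.2 0
  have h1 := C.2 1
  linarith

open Classical in
theorem sum_flatVec_le (hw : ∀ i, w i ∈ Set.Icc (0 : ℝ) 1) {ν : ℝ} (d : Fin 2)
    (hvol : ∑ i with i ∉ P.large δ, w i * P.v i d ≤ ν * r d) :
    ∑ i, P.flatVec δ n e r w d i ≤ ν * r d := by
  refine le_trans ?_ hvol
  rw [Finset.sum_filter]
  refine Finset.sum_le_sum fun i _ => ?_
  have h1 := mul_nonneg (hw i).1 (P.v_nonneg i d)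
  by_cases hi : i ∈ P.large δ
  · simp [flatVec, hi, finInd_flat_of_large]
  · simpa [flatVec, hi] using mul_le_of_le_one_left h1 (finInd_le_one _ _)

-- In dimension e the steep volume is at most ν r e < ν/n². Steepness divides the other volume by r
-- e · n², so there too it is at most ν/n². If r e · n² ≥ 1, no item is steep.
open Classical in
theorem sum_steepVec_le (hn : 0 < n) (hw : ∀ i, w i ∈ Set.Icc (0 : ℝ) 1) {ν : ℝ} (hν : 0 ≤ ν)
    (hr : ∀ d, 0 ≤ r d)
    (hvol : ∑ i with i ∉ P.large δ, w i * P.v i e ≤ ν * r e) :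
    ∑ i, P.steepVec δ n e r w i ≤ 2 * ν / n ^ 2 := by
  have hn2 : (0 : ℝ) < (n : ℝ) ^ 2 := by positivity
  set a : I → ℝ := fun i => finInd (P.steep δ n e r) i * (w i * P.v i e) with ha
  set b : I → ℝ := fun i => finInd (P.steep δ n e r) i * (w i * P.v i (e + 1)) with hb
  have hab : ∀ i, P.steepVec δ n e r w i = a i + b i := by
    intro i
    simp only [ha, hb, steepVec]
    have : P.v i 0 + P.v i 1 = P.v i e + P.v i (e + 1) := by
      fin_cases e
      · simp
      · simp [add_comm]
    rw [this]
    ring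
  have ha0 : ∀ i, 0 ≤ a i := fun i =>
    mul_nonneg (finInd_nonneg _ _) (mul_nonneg (hw i).1 (P.v_nonneg i _))
  have hsa : ∑ i, a i ≤ ν * r e := by
    refine le_trans ?_ hvol
    rw [Finset.sum_filter]
    refine Finset.sum_le_sum fun i _ => ?_
    have h1 := mul_nonneg (hw i).1 (P.v_nonneg i e)
    by_cases hi : i ∈ P.large δ
    · simp [ha, hi, finInd_steep_of_large]
    · simpa [ha, hi] using mul_le_of_le_one_left h1 (finInd_le_one _ _)
  by_cases hre : r e * (n : ℝ) ^ 2 < 1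
  · have hre' : r e ≤ 1 / (n : ℝ) ^ 2 := by rw [le_div_iff₀ hn2]; exact hre.le
    have hrb : ∀ i, r e * (n : ℝ) ^ 2 * b i ≤ a i := by
      intro i
      by_cases hi : i ∈ P.steep δ n e r
      · simp only [ha, hb, finInd, hi, if_true, one_mul]
        simp only [steep, Finset.mem_filter, Finset.mem_univ, true_and] at hi
        nlinarith [(hw i).1, hi.2.2.le]
      · simp [ha, hb, finInd, hi]
    have hsb : ∑ i, b i ≤ ν / n ^ 2 := by
      -- When r e = 0, division is unavailable; but a steep item then has positive volume in
      -- dimension e, so the volume bound forces its weight to vanish.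
      rcases (hr e).eq_or_lt with h0 | h0
      · rw [← h0, mul_zero] at hsa
        have hz : ∀ i, a i = 0 := fun i => by
          have := Finset.single_le_sum (f := a) (fun i _ => ha0 i) (Finset.mem_univ i)
          linarith [ha0 i]
        have hbz : ∀ i, b i = 0 := by
          intro i
          by_cases hi : i ∈ P.steep δ n e r
          · have h1 := hz i
            simp only [ha, hb, finInd, hi, if_true, one_mul] at h1 ⊢
            simp only [steep, Finset.mem_filter, Finset.mem_univ, true_and, ← h0, zero_mul] at hi
            rcases mul_eq_zero.mp h1 with h2 | h2
            · simp [h2]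
            · exact absurd h2 hi.2.2.ne'
          · simp [hb, finInd, hi]
        simp only [hbz, Finset.sum_const_zero]
        positivity
      · have h1 : r e * (n : ℝ) ^ 2 * ∑ i, b i ≤ ν * r e := by
          rw [Finset.mul_sum]
          exact (Finset.sum_le_sum fun i _ => hrb i).trans hsa
        rw [le_div_iff₀ hn2]
        nlinarith
    have hsa' : ∑ i, a i ≤ ν / n ^ 2 := by
      refine hsa.trans ?_
      rw [div_eq_mul_one_div]
      exact mul_le_mul_of_nonneg_left hre' hν
    simp_rw [hab]
    rw [Finset.sum_add_distrib]
    have : 2 * ν / (n : ℝ) ^ 2 = ν / n ^ 2 + ν / n ^ 2 := by ring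
    linarith
  · have : ∀ i, P.steepVec δ n e r w i = 0 := by
      intro i
      have hi : i ∉ P.steep δ n e r := by
        simp only [steep, Finset.mem_filter, not_and]
        intro _ _ h
        exact absurd h hre
      simp [steepVec, finInd, hi]
    simp only [this, Finset.sum_const_zero]
    positivity

end VBP2

/-! ### Splitting the demand of cells and shifting stripes -/

theorem sum_filter_comp_eq {I κ ι : Type*} [Fintype κ] [DecidableEq κ] [DecidableEq ι]
    (L : Finset I) (c : I → κ) (g : κ → ι) (f : I → ℝ) (s : ι) :
    ∑ i ∈ L with g (c i) = s, f i = ∑ k with g k = s, ∑ i ∈ L with c i = k, f i := by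
  rw [← Finset.sum_fiberwise_of_maps_to (s := L.filter fun i => g (c i) = s)
    (t := Finset.univ.filter fun k => g k = s) (g := c) (by simp)]
  refine Finset.sum_congr rfl fun k hk => ?_
  rw [Finset.filter_filter]
  refine Finset.sum_congr (Finset.filter_congr fun i _ => ?_) fun _ _ => rfl
  have := (Finset.mem_filter.mp hk).2
  constructor
  · exact fun h => h.2
  · rintro rfl
    exact ⟨this, rfl⟩

/-- A demand `z` which is dominated on every cell by the sum of the supplies `wd 0` and `wd 1`
can be split into two demands dominated by the respective supplies. -/
theorem exists_split {I κ : Type*} [Fintype κ] [DecidableEq κ] (L : Finset I)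
    (c : I → κ) (wd : Fin 2 → I → ℝ) (hwd : ∀ e i, 0 ≤ wd e i) (z : I → ℝ)
    (hz : ∀ i, z i ∈ Set.Icc (0 : ℝ) 1) (hsupp : ∀ i ∈ L, 0 < z i → 0 < ∑ e, wd e i)
    {β ε : ℝ} (hε : 0 ≤ ε)
    (hcell : ∀ k, ∑ i ∈ L with c i = k, z i ≤ β * ∑ i ∈ L with c i = k, ∑ e, wd e i + ε) :
    ∃ zd : Fin 2 → I → ℝ, (∀ e i, zd e i ∈ Set.Icc (0 : ℝ) 1) ∧ (∀ e, ∀ i ∉ L, zd e i = 0) ∧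
      (∀ i ∈ L, ∑ e, zd e i = z i) ∧
      ∀ {ι : Type} [DecidableEq ι] (g : κ → ι) (e : Fin 2) (s : ι),
        ∑ i ∈ L with g (c i) = s, zd e i
          ≤ β * ∑ i ∈ L with g (c i) = s, wd e i + Fintype.card κ * ε := by
  classical
  set D : Fin 2 → κ → ℝ := fun e k => ∑ i ∈ L with c i = k, wd e i with hD
  have hD0 : ∀ e k, 0 ≤ D e k := fun e k => Finset.sum_nonneg fun i _ => hwd e i
  have hDs : ∀ k, ∑ i ∈ L with c i = k, ∑ e, wd e i = ∑ e, D e k := fun k => Finset.sum_comm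
  -- Each cell is split in the ratio of its two total supplies, so a single inequality per cell
  -- yields both. If there is no supply the ratio is 0, which is right because z vanishes there by
  -- `hsupp`.
  set ρ : Fin 2 → κ → ℝ := fun e k => D e k / ∑ e, D e k with hρ
  have hDD0 : ∀ k, 0 ≤ ∑ e, D e k := fun k => Finset.sum_nonneg fun e _ => hD0 e k
  have hρ0 : ∀ e k, 0 ≤ ρ e k := fun e k => div_nonneg (hD0 e k) (hDD0 k)
  have hρ1 : ∀ e k, ρ e k ≤ 1 := fun e k => div_le_one_of_le₀
    (Finset.single_le_sum (f := fun e => D e k) (fun e _ => hD0 e k) (Finset.mem_univ e)) (hDD0 k)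
  have hρD : ∀ e k, ρ e k * ∑ e, D e k = D e k := by
    intro e k
    rcases (hDD0 k).eq_or_lt with h | h
    · have := Finset.single_le_sum (f := fun e => D e k) (fun e _ => hD0 e k) (Finset.mem_univ e)
      have h1 : D e k = 0 := by linarith [hD0 e k]
      rw [← h, h1, mul_zero]
    · exact div_mul_cancel₀ _ h.ne'
  have hzc : ∀ e k, ∑ i ∈ L with c i = k, z i * ρ e (c i) ≤ β * D e k + ε := by
    intro e k
    have e1 : ∑ i ∈ L with c i = k, z i * ρ e (c i) = ρ e k * ∑ i ∈ L with c i = k, z i := by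
      rw [Finset.mul_sum]
      refine Finset.sum_congr rfl fun i hi => ?_
      rw [(Finset.mem_filter.mp hi).2, mul_comm]
    have h1 := mul_le_mul_of_nonneg_left (hcell k) (hρ0 e k)
    rw [hDs, mul_add, ← mul_assoc, mul_comm _ β, mul_assoc, hρD] at h1
    rw [e1]
    have := mul_le_of_le_one_left hε (hρ1 e k)
    linarith
  refine ⟨fun e i => if i ∈ L then z i * ρ e (c i) else 0, fun e i => ?_, fun e i hi => by simp [hi],
    fun i hi => ?_, fun g e s => ?_⟩
  · dsimp only
    split_ifs
    · exact ⟨mul_nonneg (hz i).1 (hρ0 _ _), mul_le_one₀ (hz i).2 (hρ0 _ _) (hρ1 _ _)⟩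
    · simp
  · simp only [hi, if_true]
    rw [← Finset.mul_sum]
    rcases (hz i).1.eq_or_lt with h | h
    · rw [← h, zero_mul]
    · have hpos : 0 < ∑ e, D e (c i) := by
        refine lt_of_lt_of_le (hsupp i hi h) (Finset.sum_le_sum fun e _ => ?_)
        exact Finset.single_le_sum (f := fun i => wd e i) (fun j _ => hwd e j) (by simp [hi])
      have : ∑ e, ρ e (c i) = 1 := by
        simp only [hρ]
        rw [← Finset.sum_div, div_self hpos.ne']
      rw [this, mul_one]
  · have e1 : ∑ i ∈ L with g (c i) = s, (if i ∈ L then z i * ρ e (c i) else 0)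
        = ∑ i ∈ L with g (c i) = s, z i * ρ e (c i) := by
      refine Finset.sum_congr rfl fun i hi => ?_
      rw [if_pos (Finset.mem_filter.mp hi).1]
    rw [e1, sum_filter_comp_eq, sum_filter_comp_eq L c g, Finset.mul_sum]
    refine (Finset.sum_le_sum fun k _ => hzc e k).trans ?_
    rw [Finset.sum_add_distrib]
    refine add_le_add le_rfl ?_
    rw [Finset.sum_const, nsmul_eq_mul]
    refine mul_le_mul_of_nonneg_right ?_ hε
    exact_mod_cast Finset.card_le_univ _

/-- Moving every item one stripe up changes the weight of the items in a slot only slightly, except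
for the slots above the last stripe. -/
theorem sum_succ_stripe_le {I β : Type*} [DecidableEq β] (L : Finset I) (b : I → β)
    {Q : ℕ} (q : I → Fin Q) (w : I → ℝ) (hw : ∀ i, 0 ≤ w i)
    (hq : ∀ B k, (∑ i ∈ L with b i = B, w i) / Q - 1 ≤ ∑ i ∈ L with b i = B ∧ q i = k, w i ∧
      ∑ i ∈ L with b i = B ∧ q i = k, w i ≤ (∑ i ∈ L with b i = B, w i) / Q + 1)
    (s : β × Fin (Q + 1)) :
    ∑ i ∈ L with (b i, (q i).succ) = s, w i ≤ ∑ i ∈ L with (b i, (q i).castSucc) = s, w i +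
      (2 + if s.2 = Fin.last Q then (∑ i ∈ L with b i = s.1, w i) / Q else 0) := by
  obtain ⟨B, k⟩ := s
  have hr : 0 ≤ ∑ i ∈ L with (b i, (q i).castSucc) = (B, k), w i :=
    Finset.sum_nonneg fun i _ => hw i
  have hW : 0 ≤ (∑ i ∈ L with b i = B, w i) / Q :=
    div_nonneg (Finset.sum_nonneg fun i _ => hw i) (Nat.cast_nonneg _)
  -- Slot 0 receives nothing. Slot j + 1 receives stripe j in place of stripe j + 1, at a difference
  -- of at most 2. The last slot has no stripe of its own, so a whole stripe is in excess.
  refine Fin.cases ?_ (fun j => ?_) k <;> clear hr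
  · have : ∑ i ∈ L with (b i, (q i).succ) = (B, 0), w i = 0 := by
      simp [Fin.succ_ne_zero]
    rw [this]
    have hr : 0 ≤ ∑ i ∈ L with (b i, (q i).castSucc) = (B, 0), w i :=
      Finset.sum_nonneg fun i _ => hw i
    dsimp only
    split_ifs <;> linarith
  · have hr : 0 ≤ ∑ i ∈ L with (b i, (q i).castSucc) = (B, j.succ), w i :=
      Finset.sum_nonneg fun i _ => hw i
    have e1 : ∑ i ∈ L with (b i, (q i).succ) = (B, j.succ), w i
        = ∑ i ∈ L with b i = B ∧ q i = j, w i := by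
      simp only [Prod.mk.injEq, Fin.succ_inj]
    rw [e1]
    have h1 := (hq B j).2
    dsimp only
    split_ifs with hl
    · linarith
    · obtain ⟨j', hj'⟩ := Fin.eq_castSucc_of_ne_last hl
      have e2 : ∑ i ∈ L with (b i, (q i).castSucc) = (B, j.succ), w i
          = ∑ i ∈ L with b i = B ∧ q i = j', w i := by
        rw [← hj']
        simp only [Prod.mk.injEq, Fin.castSucc_inj]
      rw [e2]
      linarith [(hq B j').1]

/-! ### Types of configurations and the packing built from them -/

namespace VBP2

variable {I : Type*} [Fintype I] (P : VBP2 I)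

/-- A slot: a box together with the index of a stripe. -/
abbrev Slot (n : ℕ) : Type := (Fin 2 → Fin (4 * n ^ 2 + 1)) × Fin (n ^ 2 + 1)

/-- A cell: a box together with the indices of a stripe in each of the two orders. -/
abbrev Cell (n : ℕ) : Type := (Fin 2 → Fin (4 * n ^ 2 + 1)) × (Fin 2 → Fin (n ^ 2))

/-- The cell of an item. -/
noncomputable def cell (n : ℕ) (q : Fin 2 → I → Fin (n ^ 2)) (i : I) : Cell n :=
  (P.box n i, fun e => q e i)

/-- The slot at the stripe of an item. -/
noncomputable def slot (n : ℕ) (q : I → Fin (n ^ 2)) (i : I) : Slot n :=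
  (P.box n i, (q i).castSucc)

/-- The slot one stripe above an item. -/
noncomputable def slotAbove (n : ℕ) (q : I → Fin (n ^ 2)) (i : I) : Slot n :=
  (P.box n i, (q i).succ)

/-- The largest volume of a large item whose stripe is just below the slot `s`. -/
noncomputable def slotMax (δ : ℝ) (n : ℕ) (q : I → Fin (n ^ 2)) (s : Slot n) (d : Fin 2) : ℝ :=
  ⨆ i : {i // i ∈ P.large δ ∧ P.slotAbove n q i = s}, P.v i d

/-- The volume left for small items in a configuration with `T s` items in each slot `s`. -/
noncomputable def space (δ : ℝ) (n : ℕ) (q : I → Fin (n ^ 2)) (T : Slot n → ℕ) (d : Fin 2) : ℝ :=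
  1 - ∑ s, T s * P.slotMax δ n q s d

/-- A decomposition of the demand `w` into finitely many types of configurations. A type `t` is
given by a dimension `e t`, in which the configurations may be tight, and the number `T t s` of
large items in each slot. -/
structure Decomposition (δ : ℝ) (n : ℕ) (w : I → ℝ) (N : ℝ) (τ : Type*) where
  act : Finset τ
  e : τ → Fin 2
  T : τ → Slot n → ℕ
  wt : τ → I → ℝ
  ν : τ → ℝ
  q : Fin 2 → I → Fin (n ^ 2)
  wt_nonneg : ∀ t i, 0 ≤ wt t i
  ν_nonneg : ∀ t, 0 ≤ ν t
  sum_wt : ∀ i, ∑ t ∈ act, wt t i = w i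
  sum_ν : ∑ t ∈ act, ν t = N
  space_nonneg : ∀ t ∈ act, ∀ d, 0 ≤ P.space δ n (q (e t)) (T t) d
  -- Ensures that only dimension `e t` can be too tight for the tolerance of the flat items.
  space_slack : ∀ t ∈ act, 1 ≤ P.space δ n (q (e t)) (T t) (e t + 1) * n ^ 2
  small_volume : open Classical in ∀ t ∈ act, ∀ d,
    ∑ i with i ∉ P.large δ, wt t i * P.v i d ≤ ν t * P.space δ n (q (e t)) (T t) d
  sum_slot : ∀ t ∈ act, ∀ s, ∑ i ∈ P.large δ with P.slot n (q (e t)) i = s, wt t i = ν t * T t s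
  stripes : ∀ d B k,
    (∑ i ∈ P.large δ with P.box n i = B, ∑ t ∈ act with e t = d, wt t i) / (n ^ 2 : ℕ) - 1 ≤
      ∑ i ∈ P.large δ with P.box n i = B ∧ q d i = k, ∑ t ∈ act with e t = d, wt t i ∧
    ∑ i ∈ P.large δ with P.box n i = B ∧ q d i = k, ∑ t ∈ act with e t = d, wt t i ≤
      (∑ i ∈ P.large δ with P.box n i = B, ∑ t ∈ act with e t = d, wt t i) / (n ^ 2 : ℕ) + 1
  sum_large : ∑ i ∈ P.large δ, w i ≤ 2 * n * N

variable {P} {δ : ℝ} {n : ℕ} {w : I → ℝ} {Nm : ℝ} {τ : Type*}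

/-- `space` reserves `slotMax` for each of the `T s` places of a slot, and `slotMax` dominates every
item shifted there. Hence all exchanges allowed by the counts leave the same room for small items.
-/
theorem sum_le_slotMax (q : I → Fin (n ^ 2)) (T : Slot n → ℕ) (A : Finset I)
    (hA : A ⊆ P.large δ) (hT : ∀ s, (A.filter fun i => P.slotAbove n q i = s).card ≤ T s)
    (d : Fin 2) : ∑ i ∈ A, P.v i d ≤ 1 - P.space δ n q T d := by
  have h1 : ∀ i ∈ A, P.v i d ≤ P.slotMax δ n q (P.slotAbove n q i) d := fun i hi =>
    le_ciSup (f := fun j : {j // j ∈ P.large δ ∧ P.slotAbove n q j = P.slotAbove n q i} =>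
      P.v j d) (Set.finite_range _).bddAbove ⟨i, hA hi, rfl⟩
  have h0 : ∀ s, 0 ≤ P.slotMax δ n q s d := fun s => Real.iSup_nonneg fun i => P.v_nonneg i d
  rw [space, sub_sub_cancel, ← Finset.sum_fiberwise A (P.slotAbove n q)]
  refine Finset.sum_le_sum fun s _ => ?_
  calc ∑ i ∈ A with P.slotAbove n q i = s, P.v i d
      ≤ ∑ i ∈ A with P.slotAbove n q i = s, P.slotMax δ n q s d :=
        Finset.sum_le_sum fun i hi => by
          obtain ⟨h2, h3⟩ := Finset.mem_filter.mp hi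
          exact h3 ▸ h1 i h2
    _ = (A.filter fun i => P.slotAbove n q i = s).card * P.slotMax δ n q s d := by
        rw [Finset.sum_const, nsmul_eq_mul]
    _ ≤ T s * P.slotMax δ n q s d :=
        mul_le_mul_of_nonneg_right (by exact_mod_cast hT s) (h0 s)

namespace Decomposition

variable (c : Decomposition P δ n w Nm τ)

theorem wt_le (t : τ) (ht : t ∈ c.act) (i : I) : c.wt t i ≤ w i := by
  rw [← c.sum_wt i]
  exact Finset.single_le_sum (f := fun t => c.wt t i) (fun t _ => c.wt_nonneg t i) ht

theorem sum_sum_wt (i : I) : ∑ e, ∑ t ∈ c.act with c.e t = e, c.wt t i = w i := by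
  rw [← c.sum_wt i, Finset.sum_fiberwise]

/-- The large items can be distributed to the slots of the types. -/
theorem exists_large_distribution (z : I → ℝ) (hz : ∀ i, z i ∈ Set.Icc (0 : ℝ) 1)
    (hsupp : ∀ i, 0 < z i → 0 < w i) {β ε : ℝ} (hβ : β ∈ Set.Icc (0 : ℝ) 1) (hε : 0 ≤ ε)
    (hcell : ∀ k, ∑ i ∈ P.large δ with P.cell n c.q i = k, z i ≤
      β * ∑ i ∈ P.large δ with P.cell n c.q i = k, w i + ε)
    (N : τ → ℝ) (hN : ∀ t ∈ c.act, 1 ≤ N t) (hNν : ∀ t ∈ c.act, β * c.ν t ≤ N t) :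
    ∃ (x : τ → I → ℝ) (g : I → ℝ), (∀ i, 0 ≤ g i) ∧
      (∑ i, g i ≤ 2 * Fintype.card (Slot n) * (2 + Fintype.card (Cell n) * ε)
        + β * (2 * n * Nm) / n ^ 2) ∧
      (∀ i ∈ P.large δ, z i = ∑ t ∈ c.act, N t * x t i + g i) ∧
      (∀ i ∉ P.large δ, 0 = ∑ t ∈ c.act, N t * x t i + g i) ∧
      ∀ t ∈ c.act, x t ∈ convexHull ℝ (finInd '' {A : Finset I | A ⊆ P.large δ ∧
        ∀ s, (A.filter fun i => P.slotAbove n (c.q (c.e t)) i = s).card ≤ c.T t s}) := by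
  classical
  set wd : Fin 2 → I → ℝ := fun e i => ∑ t ∈ c.act with c.e t = e, c.wt t i with hwd
  have hwd0 : ∀ e i, 0 ≤ wd e i := fun e i => Finset.sum_nonneg fun t _ => c.wt_nonneg t i
  have hwds : ∀ i, ∑ e, wd e i = w i := c.sum_sum_wt
  obtain ⟨zd, hzd, hzd0, hzds, hzdc⟩ := exists_split (P.large δ) (P.cell n c.q) wd hwd0 z hz
    (fun i _ h => by rw [hwds]; exact hsupp i h) hε (β := β)
    (fun k => by simp only [hwds]; exact hcell k)
  set X : ℝ := Fintype.card (Cell n) * ε with hX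
  have hX0 : 0 ≤ X := mul_nonneg (Nat.cast_nonneg _) hε
  set W : Fin 2 → (Fin 2 → Fin (4 * n ^ 2 + 1)) → ℝ :=
    fun e B => ∑ i ∈ P.large δ with P.box n i = B, wd e i with hW
  have hW0 : ∀ e B, 0 ≤ W e B := fun e B => Finset.sum_nonneg fun i _ => hwd0 e i
  set err : Fin 2 → Slot n → ℝ := fun e s =>
    (2 + X) + β * (if s.2 = Fin.last (n ^ 2) then W e s.1 / (n ^ 2 : ℕ) else 0) with herr
  have hite : ∀ e (s : Slot n),
      0 ≤ (if s.2 = Fin.last (n ^ 2) then W e s.1 / (n ^ 2 : ℕ) else 0 : ℝ) := fun e s => by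
    split_ifs
    · exact div_nonneg (hW0 _ _) (Nat.cast_nonneg _)
    · exact le_rfl
  have herr0 : ∀ e s, 0 ≤ err e s := fun e s => by
    have := mul_nonneg hβ.1 (hite e s)
    simp only [herr]
    linarith
  have hdem : ∀ e s, ∑ i with P.slotAbove n (c.q e) i = s, zd e i ≤
      ∑ t ∈ c.act with c.e t = e, N t * c.T t s + err e s := by
    intro e s
    have e1 : ∑ i with P.slotAbove n (c.q e) i = s, zd e i
        = ∑ i ∈ P.large δ with P.slotAbove n (c.q e) i = s, zd e i := by
      symm
      refine Finset.sum_subset (Finset.filter_subset_filter _ (Finset.subset_univ _)) ?_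
      intro i hi hi'
      refine hzd0 e i fun hL => hi' ?_
      exact Finset.mem_filter.mpr ⟨hL, (Finset.mem_filter.mp hi).2⟩
    -- A slot for order e is a union of cells: forget the stripe of the other order and move one
    -- stripe up.
    have h1 : ∑ i ∈ P.large δ with P.slotAbove n (c.q e) i = s, zd e i ≤
        β * ∑ i ∈ P.large δ with P.slotAbove n (c.q e) i = s, wd e i + X :=
      hzdc (fun k : Cell n => ((k.1, (k.2 e).succ) : Slot n)) e s
    have h2 : ∑ i ∈ P.large δ with P.slotAbove n (c.q e) i = s, wd e i ≤
        ∑ i ∈ P.large δ with P.slot n (c.q e) i = s, wd e i +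
        (2 + if s.2 = Fin.last (n ^ 2) then W e s.1 / (n ^ 2 : ℕ) else 0) :=
      sum_succ_stripe_le (P.large δ) (P.box n) (c.q e) (wd e) (hwd0 e) (c.stripes e) s
    have h3 : ∑ i ∈ P.large δ with P.slot n (c.q e) i = s, wd e i
        = ∑ t ∈ c.act with c.e t = e, c.ν t * c.T t s := by
      simp only [hwd]
      rw [Finset.sum_comm]
      refine Finset.sum_congr rfl fun t ht => ?_
      obtain ⟨ht1, ht2⟩ := Finset.mem_filter.mp ht
      rw [← c.sum_slot t ht1 s, ht2]
    have h4 : β * ∑ t ∈ c.act with c.e t = e, c.ν t * c.T t s ≤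
        ∑ t ∈ c.act with c.e t = e, N t * c.T t s := by
      rw [Finset.mul_sum]
      refine Finset.sum_le_sum fun t ht => ?_
      rw [← mul_assoc]
      exact mul_le_mul_of_nonneg_right (hNν t (Finset.mem_filter.mp ht).1) (Nat.cast_nonneg _)
    rw [h3] at h2
    have h5 := mul_le_mul_of_nonneg_left h2 hβ.1
    rw [e1]
    simp only [herr]
    have := hβ.2
    linarith
  choose x g hg0 hgs hzx hx using fun e => exists_distribution (c.act.filter fun t => c.e t = e) N
    (fun t ht => hN t (Finset.mem_filter.mp ht).1) c.T (P.slotAbove n (c.q e)) (zd e) (hzd e)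
    (err e) (herr0 e) (hdem e)
  have hsum : ∀ i, ∑ e, zd e i = ∑ t ∈ c.act, N t * x (c.e t) t i + ∑ e, g e i := by
    intro i
    rw [Finset.sum_congr rfl fun e _ => hzx e i, Finset.sum_add_distrib]
    congr 1
    rw [← Finset.sum_fiberwise c.act c.e]
    refine Finset.sum_congr rfl fun e _ => Finset.sum_congr rfl fun t ht => ?_
    rw [(Finset.mem_filter.mp ht).2]
  refine ⟨fun t => x (c.e t) t, fun i => ∑ e, g e i, fun i => Finset.sum_nonneg fun e _ => hg0 e i,
    ?_, fun i hi => ?_, fun i hi => ?_, fun t ht => ?_⟩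
  · rw [Finset.sum_comm]
    refine (Finset.sum_le_sum fun e _ => hgs e).trans ?_
    -- Only the last slot of each box carries a term growing with the weight; over all boxes these
    -- add up to a 1/n² fraction of the large mass.
    have e1 : ∀ e, ∑ s, err e s = Fintype.card (Slot n) * (2 + X)
        + β * ((∑ i ∈ P.large δ, wd e i) / (n ^ 2 : ℕ)) := by
      intro e
      simp only [herr]
      rw [Finset.sum_add_distrib, Finset.sum_const, nsmul_eq_mul, Finset.card_univ,
        ← Finset.mul_sum, Fintype.sum_prod_type]
      simp only [Finset.sum_ite_eq', Finset.mem_univ, if_true]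
      rw [← Finset.sum_div, Finset.sum_fiberwise]
    have e3 : ∑ e, β * ((∑ i ∈ P.large δ, wd e i) / (n ^ 2 : ℕ))
        = β * ((∑ i ∈ P.large δ, w i) / (n ^ 2 : ℕ)) := by
      rw [← Finset.mul_sum, ← Finset.sum_div, Finset.sum_comm, Finset.sum_congr rfl fun i _ => hwds i]
    rw [Finset.sum_congr rfl fun e _ => e1 e, Finset.sum_add_distrib, e3]
    have h1 := c.sum_large
    have h2 : (∑ i ∈ P.large δ, w i) / ((n ^ 2 : ℕ) : ℝ) ≤ 2 * n * Nm / ((n ^ 2 : ℕ) : ℝ) := by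
      gcongr
    have h3 := mul_le_mul_of_nonneg_left h2 hβ.1
    have e2 : ∑ e : Fin 2, (Fintype.card (Slot n) : ℝ) * (2 + X)
        = 2 * Fintype.card (Slot n) * (2 + X) := by
      rw [Finset.sum_const, Finset.card_univ, Fintype.card_fin, nsmul_eq_mul]
      push_cast
      ring
    rw [e2, mul_div_assoc]
    push_cast at h3 ⊢
    linarith
  · rw [← hzds i hi, hsum]
  · rw [← hsum i]
    simp [hzd0 _ i hi]
  · refine convexHull_mono (Set.image_mono ?_) (hx (c.e t) t (Finset.mem_filter.mpr ⟨ht, rfl⟩))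
    rintro A ⟨hA, hAs⟩
    refine ⟨fun i hi => ?_, hAs⟩
    by_contra hL
    have := hA i hi
    rw [hzd0 _ i hL] at this
    exact lt_irrefl _ this

end Decomposition

end VBP2

namespace VBP2

variable {I : Type*} [Fintype I] {P : VBP2 I} {δ : ℝ} {n : ℕ} {w : I → ℝ} {Nm : ℝ} {τ : Type*}

theorem v_le_of_small {i : I} (hi : i ∉ P.large δ) (d : Fin 2) : P.v i d ≤ δ := by
  classical
  simp only [large, Finset.mem_filter, Finset.mem_univ, true_and, not_exists, not_lt] at hi
  exact hi d

theorem sum_mul_le_of_mul_le {z w u : I → ℝ} {β a b : ℝ} (hβ : 0 ≤ β) (hw : ∀ i, w i ≤ 1)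
    (hu : ∀ i, 0 ≤ u i) (h : ∑ i, z i * u i ≤ β * ∑ i, w i * u i + a) (hb : ∑ i, u i ≤ b) :
    ∑ i, z i * u i ≤ β * b + a := by
  refine h.trans (add_le_add (mul_le_mul_of_nonneg_left (le_trans ?_ hb) hβ) le_rfl)
  exact Finset.sum_le_sum fun i _ => mul_le_of_le_one_left (hu i) (hw i)

namespace Decomposition

variable (c : Decomposition P δ n w Nm τ)

/-- The vector of the steep small items can be packed cheaply. -/
theorem pack_steep (hn : 0 < n) (hδ : δ ≤ (n : ℝ)⁻¹) (hw : ∀ i, w i ∈ Set.Icc (0 : ℝ) 1)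
    (z : I → ℝ) (hz : ∀ i, z i ∈ Set.Icc (0 : ℝ) 1)
    {β κ : ℝ} (hβ : β ∈ Set.Icc (0 : ℝ) 1) (hκ : 0 ≤ κ)
    (hsteep : ∀ t ∈ c.act,
      ∑ i, z i * P.steepVec δ n (c.e t) (P.space δ n (c.q (c.e t)) (c.T t)) (c.wt t) i ≤
      β * ∑ i, w i * P.steepVec δ n (c.e t) (P.space δ n (c.q (c.e t)) (c.T t)) (c.wt t) i
        + κ * 2) :
    P.Pack (fun i => ∑ t ∈ c.act,
        finInd (P.steep δ n (c.e t) (P.space δ n (c.q (c.e t)) (c.T t))) i * (z i * c.wt t i))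
      ((1 + 2 * (n : ℝ)⁻¹) * (2 * β * Nm / n ^ 2 + 2 * κ * c.act.card + 1) + 1) := by
  classical
  have hwt : ∀ t ∈ c.act, ∀ i, c.wt t i ∈ Set.Icc (0 : ℝ) 1 := fun t ht i =>
    ⟨c.wt_nonneg t i, (c.wt_le t ht i).trans (hw i).2⟩
  set s : I → ℝ := fun i => ∑ t ∈ c.act,
    finInd (P.steep δ n (c.e t) (P.space δ n (c.q (c.e t)) (c.T t))) i * (z i * c.wt t i) with hs
  have hterm : ∀ t i, 0 ≤ z i * c.wt t i := fun t i => mul_nonneg (hz i).1 (c.wt_nonneg t i)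
  have hs0 : ∀ i, 0 ≤ s i := fun i => Finset.sum_nonneg fun t _ =>
    mul_nonneg (finInd_nonneg _ _) (hterm t i)
  have hs1 : ∀ i, s i ≤ 1 := by
    intro i
    calc s i ≤ ∑ t ∈ c.act, z i * c.wt t i := Finset.sum_le_sum fun t _ =>
          mul_le_of_le_one_left (hterm t i) (finInd_le_one _ _)
      _ = z i * w i := by rw [← Finset.mul_sum, c.sum_wt]
      _ ≤ 1 := mul_le_one₀ (hz i).2 (hw i).1 (hw i).2
  have hslarge : ∀ i ∈ P.large δ, s i = 0 := fun i hi =>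
    Finset.sum_eq_zero fun t _ => by rw [finInd_steep_of_large hi, zero_mul]
  set V : ℝ := 2 * β * Nm / n ^ 2 + 2 * κ * c.act.card with hV
  have hNm : 0 ≤ Nm := by
    rw [← c.sum_ν]
    exact Finset.sum_nonneg fun t _ => c.ν_nonneg t
  have hV0 : 0 ≤ V := by
    have := hβ.1
    positivity
  have hvol : ∑ i, (P.v i 0 + P.v i 1) * s i ≤ V := by
    have e1 : ∑ i, (P.v i 0 + P.v i 1) * s i = ∑ t ∈ c.act, ∑ i, z i *
        P.steepVec δ n (c.e t) (P.space δ n (c.q (c.e t)) (c.T t)) (c.wt t) i := by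
      rw [Finset.sum_comm]
      refine Finset.sum_congr rfl fun i _ => ?_
      simp only [hs, Finset.mul_sum, steepVec]
      exact Finset.sum_congr rfl fun t _ => by ring
    have h1 : ∀ t ∈ c.act, ∑ i, z i *
        P.steepVec δ n (c.e t) (P.space δ n (c.q (c.e t)) (c.T t)) (c.wt t) i ≤
        β * (2 * c.ν t / n ^ 2) + κ * 2 := fun t ht =>
      sum_mul_le_of_mul_le hβ.1 (fun i => (hw i).2) (steepVec_nonneg (hwt t ht)) (hsteep t ht)
        (sum_steepVec_le hn (hwt t ht) (c.ν_nonneg t) (c.space_nonneg t ht)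
          (c.small_volume t ht (c.e t)))
    rw [e1]
    refine (Finset.sum_le_sum h1).trans (le_of_eq ?_)
    rw [Finset.sum_add_distrib, ← Finset.mul_sum, ← Finset.sum_div, ← Finset.mul_sum, c.sum_ν,
      Finset.sum_const, nsmul_eq_mul, hV]
    ring
  have hN0 : 0 < V + 1 := by linarith
  -- V + 1 empty bins with the full space 1 in each dimension and no large items, each filled with
  -- the fraction 1/(V+1) of the steep vector.
  have key := pack_bins (P := P) hn (Finset.univ : Finset Unit) (fun _ => V + 1)
    (fun _ _ => hN0.le) (fun _ _ => 1) (fun _ => finInd ∅) (fun _ i => s i / (V + 1))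
    (fun _ => {∅}) (fun _ _ A hA => ?_) (fun _ _ => ?_) (fun _ _ i => ?_) (fun _ _ e => ?_)
    (fun _ _ i hi e => ?_) (fun i => ?_)
  · have h1 : P.Pack s (V + 1 + ((n : ℝ)⁻¹ * (2 * (V + 1)) + 1)) := by
      convert key using 1
      · funext i
        simp [finInd]
        field_simp
      · simp
    exact h1.mono (le_of_eq (by ring))
  · rw [Set.mem_singleton_iff.mp hA]
    simp
  · exact subset_convexHull ℝ _ ⟨∅, rfl, rfl⟩
  · refine ⟨div_nonneg (hs0 i) hN0.le, div_le_one_of_le₀ ?_ hN0.le⟩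
    linarith [hs1 i]
  · have e1 : ∑ i, P.v i e * (s i / (V + 1)) = (∑ i, P.v i e * s i) / (V + 1) := by
      rw [Finset.sum_div]
      exact Finset.sum_congr rfl fun i _ => by ring
    rw [e1, div_le_one hN0]
    have : ∑ i, P.v i e * s i ≤ ∑ i, (P.v i 0 + P.v i 1) * s i := by
      refine Finset.sum_le_sum fun i _ => mul_le_mul_of_nonneg_right ?_ (hs0 i)
      have h0 := P.v_nonneg i 0
      have h1 := P.v_nonneg i 1
      fin_cases e <;> simp <;> assumption
    linarith
  · refine (v_le_of_small (fun hL => ?_) e).trans hδ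
    rw [hslarge i hL] at hi
    simp at hi
  · simp only [Finset.univ_unique, Finset.sum_singleton]
    rw [mul_div_cancel₀ _ hN0.ne']
    exact hs1 i

/-- A demand which obeys the linear constraints given by the cells and by the volumes of the small
items of each type can be packed. -/
theorem pack_of_constraints (hn : 0 < n) (hδ : δ ≤ (n : ℝ)⁻¹)
    (hw : ∀ i, w i ∈ Set.Icc (0 : ℝ) 1) (hws : ∀ i ∉ P.large δ, w i = 0 ∨ w i = 1)
    (z : I → ℝ) (hz : ∀ i, z i ∈ Set.Icc (0 : ℝ) 1) (hsupp : ∀ i, 0 < z i → 0 < w i)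
    {β κ ε : ℝ} (hβ : β ∈ Set.Icc (0 : ℝ) 1) (hκ : 0 ≤ κ) (hε : 0 ≤ ε)
    (hcell : ∀ k, ∑ i ∈ P.large δ with P.cell n c.q i = k, z i ≤
      β * ∑ i ∈ P.large δ with P.cell n c.q i = k, w i + ε)
    (hflat : ∀ t ∈ c.act, ∀ d,
      ∑ i, z i * P.flatVec δ n (c.e t) (P.space δ n (c.q (c.e t)) (c.T t)) (c.wt t) d i ≤
      β * ∑ i, w i * P.flatVec δ n (c.e t) (P.space δ n (c.q (c.e t)) (c.T t)) (c.wt t) d i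
        + κ * (P.space δ n (c.q (c.e t)) (c.T t) d * n ^ 2))
    (hsteep : ∀ t ∈ c.act,
      ∑ i, z i * P.steepVec δ n (c.e t) (P.space δ n (c.q (c.e t)) (c.T t)) (c.wt t) i ≤
      β * ∑ i, w i * P.steepVec δ n (c.e t) (P.space δ n (c.q (c.e t)) (c.T t)) (c.wt t) i
        + κ * 2) :
    P.Pack z ((1 + 2 * (n : ℝ)⁻¹) * (β * Nm + c.act.card * (κ * n ^ 2 + 1)) + 1
      + ((1 + 2 * (n : ℝ)⁻¹) * (2 * β * Nm / n ^ 2 + 2 * κ * c.act.card + 1) + 1)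
      + (2 * Fintype.card (Slot n) * (2 + Fintype.card (Cell n) * ε)
        + β * (2 * n * Nm) / n ^ 2)) := by
  classical
  have hwt : ∀ t ∈ c.act, ∀ i, c.wt t i ∈ Set.Icc (0 : ℝ) 1 := fun t ht i =>
    ⟨c.wt_nonneg t i, (c.wt_le t ht i).trans (hw i).2⟩
  have hterm : ∀ t i, 0 ≤ z i * c.wt t i := fun t i => mul_nonneg (hz i).1 (c.wt_nonneg t i)
  set r : τ → Fin 2 → ℝ := fun t => P.space δ n (c.q (c.e t)) (c.T t) with hr
  -- β ν t bins imitate the solution, κ n² bins absorb the error κ · r d · n² of the flat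
  -- constraints, and one more gives N t ≥ 1 as the distribution of large items requires.
  set N : τ → ℝ := fun t => β * c.ν t + κ * n ^ 2 + 1 with hN
  have hβν : ∀ t, 0 ≤ β * c.ν t := fun t => mul_nonneg hβ.1 (c.ν_nonneg t)
  have hκn : 0 ≤ κ * (n : ℝ) ^ 2 := by positivity
  have hN1 : ∀ t, 1 ≤ N t := fun t => by simp only [hN]; linarith [hβν t]
  have hN0 : ∀ t, 0 < N t := fun t => lt_of_lt_of_le one_pos (hN1 t)
  obtain ⟨x, g, hg0, hgs, hzL, hzS, hx⟩ := c.exists_large_distribution z hz hsupp hβ hε hcell N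
    (fun t _ => hN1 t) (fun t _ => by simp only [hN]; linarith)
  -- Small items are shared in the proportions `wt t`. Nothing is lost, since w is 0 or 1 on small
  -- items and equals 1 wherever z is positive.
  set y : τ → I → ℝ := fun t i =>
    finInd (P.flat δ n (c.e t) (r t)) i * (z i * c.wt t i) / N t with hy
  have hyN : ∀ t i, N t * y t i = finInd (P.flat δ n (c.e t) (r t)) i * (z i * c.wt t i) :=
    fun t i => mul_div_cancel₀ _ (hN0 t).ne'
  have hylarge : ∀ t, ∀ i ∈ P.large δ, y t i = 0 := fun t i hi => by
    simp [hy, finInd_flat_of_large hi]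
  have hy0 : ∀ t i, 0 ≤ y t i := fun t i =>
    div_nonneg (mul_nonneg (finInd_nonneg _ _) (hterm t i)) (hN0 t).le
  have hsumzw : ∀ i, ∑ t ∈ c.act, z i * c.wt t i = z i * w i := fun i => by
    rw [← Finset.mul_sum, c.sum_wt]
  have hmain := pack_bins (P := P) hn c.act N (fun t _ => (hN0 t).le) r x y
    (fun t => {A : Finset I | A ⊆ P.large δ ∧
        ∀ s, (A.filter fun i => P.slotAbove n (c.q (c.e t)) i = s).card ≤ c.T t s})
    (fun t _ A hA => ⟨fun i hi => hylarge t i (hA.1 hi),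
      sum_le_slotMax (c.q (c.e t)) (c.T t) A hA.1 hA.2⟩) hx ?_ ?_ ?_ ?_
  · have hst := c.pack_steep hn hδ hw z hz hβ hκ hsteep
    have hgp := (pack_singles (P := P) hg0).mono hgs
    have hall := (hmain.add hst).add hgp
    have ez : z = (∑ t ∈ c.act, N t • (x t + y t)) + (fun i => ∑ t ∈ c.act,
        finInd (P.steep δ n (c.e t) (r t)) i * (z i * c.wt t i)) + g := by
      funext i
      simp only [Pi.add_apply, Finset.sum_apply, Pi.smul_apply, smul_eq_mul, mul_add,
        Finset.sum_add_distrib, hyN]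
      by_cases hi : i ∈ P.large δ
      · simp only [finInd_flat_of_large hi, finInd_steep_of_large hi, zero_mul,
          Finset.sum_const_zero, add_zero]
        exact hzL i hi
      · have e1 : ∑ t ∈ c.act, finInd (P.flat δ n (c.e t) (r t)) i * (z i * c.wt t i)
            + ∑ t ∈ c.act, finInd (P.steep δ n (c.e t) (r t)) i * (z i * c.wt t i) = z i := by
          rw [← Finset.sum_add_distrib]
          simp_rw [← add_mul, finInd_flat_add_steep i hi, one_mul]
          rw [hsumzw]
          rcases (hz i).1.eq_or_lt with h | h
          · rw [← h, zero_mul]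
          · rcases hws i hi with h1 | h1
            · exact absurd h1 (hsupp i h).ne'
            · rw [h1, mul_one]
        have := hzS i hi
        linarith
    rw [← ez] at hall
    refine hall.mono (le_of_eq ?_)
    have eN : ∑ t ∈ c.act, N t = β * Nm + c.act.card * (κ * n ^ 2 + 1) := by
      simp only [hN, add_assoc]
      rw [Finset.sum_add_distrib, ← Finset.mul_sum, c.sum_ν, Finset.sum_const, nsmul_eq_mul]
    rw [eN]
    ring
  · intro t ht i
    refine ⟨hy0 t i, div_le_one_of_le₀ ?_ (hN0 t).le⟩
    refine le_trans ?_ (hN1 t)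
    exact mul_le_one₀ (finInd_le_one _ _) (hterm t i)
      (mul_le_one₀ (hz i).2 (hwt t ht i).1 (hwt t ht i).2)
  · intro t ht d
    have e1 : ∑ i, P.v i d * y t i
        = (∑ i, z i * P.flatVec δ n (c.e t) (r t) (c.wt t) d i) / N t := by
      rw [Finset.sum_div]
      refine Finset.sum_congr rfl fun i _ => ?_
      simp only [hy, flatVec]
      ring
    rw [e1, div_le_iff₀ (hN0 t)]
    refine (sum_mul_le_of_mul_le hβ.1 (fun i => (hw i).2) (flatVec_nonneg (hwt t ht) d)
      (hflat t ht d) (sum_flatVec_le (hwt t ht) d (c.small_volume t ht d))).trans ?_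
    have h1 : 0 ≤ r t d := c.space_nonneg t ht d
    simp only [hN]
    change β * (c.ν t * r t d) + κ * (r t d * n ^ 2) ≤ _
    nlinarith
  · intro t _ i hi e
    refine (v_le_of_small (fun hL => ?_) e).trans hδ
    rw [hylarge t i hL] at hi
    exact lt_irrefl _ hi
  · intro i
    simp_rw [hyN]
    calc ∑ t ∈ c.act, finInd (P.flat δ n (c.e t) (r t)) i * (z i * c.wt t i)
        ≤ ∑ t ∈ c.act, z i * c.wt t i := Finset.sum_le_sum fun t _ =>
          mul_le_of_le_one_left (hterm t i) (finInd_le_one _ _)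
      _ = z i * w i := hsumzw i
      _ ≤ 1 := mul_le_one₀ (hz i).2 (hw i).1 (hw i).2

end Decomposition

end VBP2

/-! ### Every solution with slack has a decomposition -/

namespace VBP2

variable {I : Type*} [Fintype I] {P : VBP2 I} {δ : ℝ} {n : ℕ}

/-- The items shifted into the slot of j lie one stripe lower in the same box: in dimension e they
precede j in the order, and in the other dimension only the mesh of the boxes bounds the excess. -/
theorem slotMax_le (hn : 0 < n) (e : Fin 2) (q : I → Fin (n ^ 2))
    (hq : ∀ i j, P.box n i = P.box n j → P.key e i ≤ P.key e j → q i ≤ q j) (j : I) (d : Fin 2) :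
    P.slotMax δ n q (P.slot n q j) d ≤ P.v j d + if d = e then 0 else 1 / (4 * (n : ℝ) ^ 2) := by
  have h0 : (0 : ℝ) ≤ if d = e then 0 else 1 / (4 * (n : ℝ) ^ 2) := by
    split_ifs
    · exact le_rfl
    · positivity
  refine Real.iSup_le ?_ (add_nonneg (P.v_nonneg j d) h0)
  rintro ⟨i, -, hij⟩
  have hbox : P.box n i = P.box n j := congrArg Prod.fst hij
  have hqq : (q i).succ = (q j).castSucc := congrArg Prod.snd hij
  split_ifs with hd
  · subst hd
    rw [add_zero]
    refine P.v_le_of_key_le (le_of_not_ge fun h => ?_)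
    have h1 := hq j i hbox.symm h
    have h2 := congrArg Fin.val hqq
    simp only [Fin.val_succ, Fin.val_castSucc] at h2
    have h3 : (q j).val ≤ (q i).val := h1
    omega
  · exact P.v_le_of_box_eq hn hbox d

/-- The number of large items of a multi-configuration in a slot. -/
noncomputable def slotCount (P : VBP2 I) (δ : ℝ) (n : ℕ) (q : I → Fin (n ^ 2))
    (C : P.MultiConfig) (s : Slot n) : ℕ := ∑ i ∈ P.large δ with P.slot n q i = s, C.1 i

theorem slotCount_le (hδ : 0 < δ) (hδn : δ⁻¹ = n) (q : I → Fin (n ^ 2)) (C : P.MultiConfig)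
    (s : Slot n) : P.slotCount δ n q C s ≤ 2 * n := by
  have h1 := sum_large_le hδ C
  rw [hδn] at h1
  have h2 : P.slotCount δ n q C s ≤ ∑ i ∈ P.large δ, C.1 i :=
    Finset.sum_le_sum_of_subset (Finset.filter_subset _ _)
  have h3 : ∑ i ∈ P.large δ, C.1 i ≤ 2 * n := by exact_mod_cast h1
  exact h2.trans h3

open Classical in
/-- The small items of a multi-configuration fit into the space which its type leaves for them,
even after shifting the large items. -/
theorem small_volume_le (hδ : 0 < δ) (hδn : δ⁻¹ = n) (hn : 0 < n) (e : Fin 2)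
    (q : I → Fin (n ^ 2))
    (hq : ∀ i j, P.box n i = P.box n j → P.key e i ≤ P.key e j → q i ≤ q j)
    (C : P.MultiConfig) (hC : P.mvol C.1 (e + 1) ≤ 1 - δ) (d : Fin 2) :
    ∑ i with i ∉ P.large δ, (C.1 i : ℝ) * P.v i d + (if d = e then 0 else δ / 2) ≤
      P.space δ n q (P.slotCount δ n q C) d := by
  have hn' : (0 : ℝ) < n := by exact_mod_cast hn
  set η : ℝ := if d = e then 0 else 1 / (4 * (n : ℝ) ^ 2) with hη
  have hη0 : 0 ≤ η := by
    rw [hη]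
    split_ifs
    · exact le_rfl
    · positivity
  have h1 : ∑ s, (P.slotCount δ n q C s : ℝ) * P.slotMax δ n q s d ≤
      ∑ i ∈ P.large δ, (C.1 i : ℝ) * (P.v i d + η) := by
    rw [← Finset.sum_fiberwise (P.large δ) (P.slot n q)]
    refine Finset.sum_le_sum fun s _ => ?_
    unfold slotCount
    rw [Nat.cast_sum, Finset.sum_mul]
    refine Finset.sum_le_sum fun i hi => mul_le_mul_of_nonneg_left ?_ (Nat.cast_nonneg _)
    rw [← (Finset.mem_filter.mp hi).2]
    exact slotMax_le hn e q hq i d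
  have h2 : ∑ i ∈ P.large δ, (C.1 i : ℝ) * (P.v i d + η) ≤
      ∑ i ∈ P.large δ, (C.1 i : ℝ) * P.v i d + 2 * n * η := by
    simp_rw [mul_add]
    rw [Finset.sum_add_distrib, ← Finset.sum_mul, ← hδn]
    exact add_le_add le_rfl (mul_le_mul_of_nonneg_right (sum_large_le hδ C) hη0)
  have h3 : P.mvol C.1 d = ∑ i ∈ P.large δ, (C.1 i : ℝ) * P.v i d
      + ∑ i with i ∉ P.large δ, (C.1 i : ℝ) * P.v i d := by
    unfold mvol
    rw [← Finset.sum_filter_add_sum_filter_not Finset.univ (fun i => i ∈ P.large δ)]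
    simp
  have h4 : P.mvol C.1 d + 2 * n * η + (if d = e then 0 else δ / 2) ≤ 1 := by
    rw [hη]
    split_ifs with hd
    · have := C.2 d
      linarith
    · have hde : ∀ d e : Fin 2, d ≠ e → d = e + 1 := by decide
      rw [← hde d e hd] at hC
      -- At most 2n large items, each growing by at most 1/(4n²), use up half of the slack; the
      -- other half stays free.
      have e1 : 2 * (n : ℝ) * (1 / (4 * (n : ℝ) ^ 2)) = δ / 2 := by
        have : δ = (n : ℝ)⁻¹ := by rw [← hδn, inv_inv]
        rw [this]
        field_simp
        norm_num
      rw [e1]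
      linarith
  unfold space
  linarith

/-- Every fractional solution with slack has a decomposition. -/
theorem exists_decomposition (hδ : 0 < δ) (hδn : δ⁻¹ = n) (hn : 2 ≤ n) {lam : P.MultiConfig → ℝ}
    (hlam : P.IsFractional lam) (hslack : P.WithSlack δ lam) :
    ∃ c : P.Decomposition δ n (P.coverage lam) (P.norm1 lam)
        (Fin 2 × (Slot n → Fin (2 * n + 1))),
      ∀ e i j, P.box n i = P.box n j → P.key e i ≤ P.key e j → c.q e i ≤ c.q e j := by
  classical
  have hn0 : 0 < n := by omega
  have hn' : (2 : ℝ) ≤ n := by exact_mod_cast hn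
  have hδ' : δ = (n : ℝ)⁻¹ := by rw [← hδn, inv_inv]
  have hl := hlam.isSummableWeight
  have hclex : ∀ C : P.MultiConfig, ∃ e : Fin 2, 0 < lam C → P.mvol C.1 (e + 1) ≤ 1 - δ := by
    intro C
    by_cases h : 0 < lam C
    · obtain ⟨d, hd⟩ := hslack C h
      -- The class is the dimension opposite to a slack one, since d + 1 + 1 = d in `Fin 2`.
      refine ⟨d + 1, fun _ => ?_⟩
      have : ∀ d : Fin 2, d + 1 + 1 = d := by decide
      rwa [this]
    · exact ⟨0, fun h' => absurd h' h⟩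
  choose cl hcl using hclex
  set wd : Fin 2 → I → ℝ := fun e i => P.coverage (part cl lam e) i with hwd
  have hwd01 : ∀ e i, wd e i ∈ Set.Icc (0 : ℝ) 1 := fun e i => by
    refine ⟨(hl.part e).coverage_nonneg i, le_trans ?_ (hlam.coverage_le i)⟩
    rw [← sum_coverage_part (f := cl) hl i]
    exact Finset.single_le_sum (f := fun e => P.coverage (part cl lam e) i)
      (fun e _ => (hl.part e).coverage_nonneg i) (Finset.mem_univ e)
  -- The stripes of order e balance only the coverage of the multi-configurations of class e,
  -- separately in each box.
  choose q0 hq0lt hq0mono hq0 using fun (e : Fin 2) (B : Fin 2 → Fin (4 * n ^ 2 + 1)) =>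
    exists_stripes (P.key e) (P.key_injective e) ((P.large δ).filter fun i => P.box n i = B)
      (wd e) (hwd01 e) (pow_pos hn0 2)
  set q : Fin 2 → I → Fin (n ^ 2) := fun e i => ⟨q0 e (P.box n i) i, hq0lt e _ i⟩ with hqdef
  have hq : ∀ e i j, P.box n i = P.box n j → P.key e i ≤ P.key e j → q e i ≤ q e j := by
    intro e i j hB hk
    change q0 e (P.box n i) i ≤ q0 e (P.box n j) j
    rw [hB]
    exact hq0mono e _ i j hk
  set typ : P.MultiConfig → Fin 2 × (Slot n → Fin (2 * n + 1)) := fun C =>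
    (cl C, fun s => ⟨P.slotCount δ n (q (cl C)) C s,
      Nat.lt_succ_of_le (slotCount_le hδ hδn _ C s)⟩) with htyp
  set act : Finset (Fin 2 × (Slot n → Fin (2 * n + 1))) :=
    {t | ∃ C, 0 < lam C ∧ typ C = t} with hact
  have hpart0 : ∀ t ∉ act, part typ lam t = 0 := by
    intro t ht
    funext C
    by_contra hC
    obtain ⟨h1, h2⟩ := of_part_pos (lt_of_le_of_ne (part_nonneg hl.nonneg t C) (Ne.symm hC))
    exact ht (by simpa [hact] using ⟨C, h2, h1⟩)
  have hwt0 : ∀ t ∉ act, ∀ i, P.coverage (part typ lam t) i = 0 := fun t ht i => by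
    simp [hpart0 t ht, coverage]
  have hν0 : ∀ t ∉ act, P.norm1 (part typ lam t) = 0 := fun t ht => by
    simp [hpart0 t ht, norm1]
  have hT : ∀ C t, typ C = t → P.slotCount δ n (q t.1) C = fun s => (t.2 s : ℕ) := by
    rintro C t rfl
    rfl
  have hspace : ∀ t C d, typ C = t → 0 < lam C →
      ∑ i with i ∉ P.large δ, (C.1 i : ℝ) * P.v i d + (if d = t.1 then 0 else δ / 2) ≤
        P.space δ n (q t.1) (fun s => (t.2 s : ℕ)) d := by
    intro t C d ht hC
    rw [← hT C t ht]
    subst ht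
    exact small_volume_le hδ hδn hn0 _ _ (hq _) C (hcl C hC) d
  have hvol0 : ∀ (C : P.MultiConfig) d,
      0 ≤ ∑ i with i ∉ P.large δ, (C.1 i : ℝ) * P.v i d := fun C d =>
    Finset.sum_nonneg fun i _ => mul_nonneg (Nat.cast_nonneg _) (P.v_nonneg i d)
  have hfib : ∀ e i, ∑ t ∈ act with t.1 = e, P.coverage (part typ lam t) i = wd e i := by
    intro e i
    have := sum_coverage_part_fiber (f := typ) (fun t => t.1) hl e i
    refine Eq.trans ?_ this
    refine Finset.sum_subset (Finset.filter_subset_filter _ (Finset.subset_univ _)) ?_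
    intro t ht ht'
    refine hwt0 t (fun h => ht' ?_) i
    exact Finset.mem_filter.mpr ⟨h, (Finset.mem_filter.mp ht).2⟩
  refine ⟨⟨act, fun t => t.1, fun t s => (t.2 s : ℕ), fun t => P.coverage (part typ lam t),
    fun t => P.norm1 (part typ lam t), q, fun t i => (hl.part t).coverage_nonneg i,
    fun t => (hl.part t).norm1_nonneg, fun i => ?_, ?_, fun t ht d => ?_, fun t ht => ?_,
    fun t ht d => ?_, fun t ht s => ?_, fun e B k => ?_, ?_⟩, hq⟩
  · rw [← sum_coverage_part (f := typ) hl i]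
    exact Finset.sum_subset (Finset.subset_univ _) fun t _ ht => hwt0 t ht i
  · rw [← sum_norm1_part (f := typ) hl]
    exact Finset.sum_subset (Finset.subset_univ _) fun t _ ht => hν0 t ht
  · obtain ⟨C, hC, hCt⟩ := (Finset.mem_filter.mp ht).2
    refine le_trans ?_ (hspace t C d hCt hC)
    refine add_nonneg (hvol0 C d) ?_
    split_ifs
    · exact le_rfl
    · linarith
  · obtain ⟨C, hC, hCt⟩ := (Finset.mem_filter.mp ht).2
    have h1 := hspace t C (t.1 + 1) hCt hC
    have h2 : ∀ e : Fin 2, ¬ e + 1 = e := by decide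
    rw [if_neg (h2 t.1)] at h1
    -- The remaining half of the slack, multiplied by n², is n/2 ≥ 1.
    have h3 : δ / 2 ≤ P.space δ n (q t.1) (fun s => (t.2 s : ℕ)) (t.1 + 1) := by
      linarith [hvol0 C (t.1 + 1)]
    have h4 : δ / 2 * (n : ℝ) ^ 2 = n / 2 := by
      rw [hδ']
      field_simp
    calc (1 : ℝ) ≤ n / 2 := by linarith
      _ = δ / 2 * (n : ℝ) ^ 2 := h4.symm
      _ ≤ _ := mul_le_mul_of_nonneg_right h3 (by positivity)
  · have h1 := (hl.part (f := typ) t).sum_mul_coverage_le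
      (fun i => if i ∉ P.large δ then P.v i d else 0)
      (P.space δ n (q t.1) (fun s => (t.2 s : ℕ)) d) fun C hC => ?_
    · rw [mul_comm (P.norm1 _)]
      refine le_trans (le_of_eq ?_) h1
      rw [Finset.sum_filter]
      refine Finset.sum_congr rfl fun i _ => ?_
      split_ifs <;> ring
    · obtain ⟨hCt, hC0⟩ := of_part_pos hC
      refine le_trans ?_ (hspace t C d hCt hC0)
      rw [Finset.sum_filter]
      have h2 : (0 : ℝ) ≤ if d = t.1 then 0 else δ / 2 := by
        split_ifs
        · exact le_rfl
        · linarith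
      refine le_trans (le_of_eq ?_) (le_add_of_nonneg_right h2)
      refine Finset.sum_congr rfl fun i _ => ?_
      split_ifs <;> ring
  · have h1 := (hl.part (f := typ) t).sum_mul_coverage_eq
      (fun i => if i ∈ P.large δ ∧ P.slot n (q t.1) i = s then 1 else 0)
      ((t.2 s : ℕ) : ℝ) fun C hC => ?_
    · rw [mul_comm (P.norm1 _), ← h1]
      simp only [ite_mul, one_mul, zero_mul]
      rw [← Finset.sum_filter]
      refine Finset.sum_congr ?_ fun _ _ => rfl
      ext i
      simp
    · obtain ⟨hCt, -⟩ := of_part_pos hC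
      have h2 : P.slotCount δ n (q t.1) C s = (t.2 s : ℕ) := congrFun (hT C t hCt) s
      rw [← h2]
      unfold slotCount
      simp only [ite_mul, one_mul, zero_mul]
      rw [← Finset.sum_filter]
      push_cast
      refine Finset.sum_congr ?_ fun _ _ => rfl
      ext i
      simp
  · simp only [hfib]
    have h1 := hq0 e B k.val k.isLt
    have h2 : ((P.large δ).filter fun i => P.box n i = B).filter (fun i => q0 e B i = k.val)
        = (P.large δ).filter fun i => P.box n i = B ∧ q e i = k := by
      rw [Finset.filter_filter]
      refine Finset.filter_congr fun i _ => ?_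
      constructor
      · rintro ⟨rfl, h⟩
        exact ⟨rfl, Fin.ext h⟩
      · rintro ⟨rfl, h⟩
        exact ⟨rfl, congrArg Fin.val h⟩
    rw [h2] at h1
    exact h1
  · have h1 := hl.sum_mul_coverage_le (fun i => if i ∈ P.large δ then 1 else 0) (2 * n)
      fun C _ => ?_
    · simpa using h1
    · have := sum_large_le hδ C
      rw [hδn] at this
      simpa using this

end VBP2

/-! ### Numerical estimates -/

theorem vbpPhi_eq {δ : ℝ} {n : ℕ} (hδn : δ⁻¹ = n) : vbpPhi δ = Real.exp ((n : ℝ) ^ 20) := by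
  unfold vbpPhi
  rw [zpow_neg, ← inv_zpow, hδn]
  norm_cast

theorem exp_pow_eight_le {n : ℕ} (hn : 11 ≤ n) :
    Real.exp ((n : ℝ) ^ 10) ^ 8 ≤ Real.exp ((n : ℝ) ^ 20) := by
  have hn' : (11 : ℝ) ≤ n := by exact_mod_cast hn
  rw [← Real.exp_nat_mul]
  refine Real.exp_le_exp.mpr ?_
  have h1 : (n : ℝ) ^ 20 = (n : ℝ) ^ 10 * (n : ℝ) ^ 10 := by ring
  have h2 : (8 : ℝ) ≤ (n : ℝ) ^ 10 := by
    calc (8 : ℝ) ≤ 11 ^ 10 := by norm_num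
      _ ≤ _ := by gcongr
  rw [h1]
  push_cast
  exact mul_le_mul_of_nonneg_right h2 (by positivity)

namespace VBP2

theorem card_box_le {n : ℕ} (hn : 11 ≤ n) : (4 * n ^ 2 + 1) ^ 2 ≤ n ^ 6 := by
  have h : 4 * n ^ 2 + 1 ≤ n ^ 3 := by nlinarith [sq_nonneg n]
  calc (4 * n ^ 2 + 1) ^ 2 ≤ (n ^ 3) ^ 2 := Nat.pow_le_pow_left h 2
    _ = n ^ 6 := by ring

theorem card_slot_le {n : ℕ} (hn : 11 ≤ n) : Fintype.card (Slot n) ≤ n ^ 9 := by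
  have h : n ^ 2 + 1 ≤ n ^ 3 := by nlinarith [sq_nonneg n]
  simp only [Slot, Fintype.card_prod, Fintype.card_fun, Fintype.card_fin]
  calc (4 * n ^ 2 + 1) ^ 2 * (n ^ 2 + 1) ≤ n ^ 6 * n ^ 3 :=
        Nat.mul_le_mul (card_box_le hn) h
    _ = n ^ 9 := by ring

theorem card_cell_le {n : ℕ} (hn : 11 ≤ n) : Fintype.card (Cell n) ≤ n ^ 10 := by
  simp only [Cell, Fintype.card_prod, Fintype.card_fun, Fintype.card_fin]
  calc (4 * n ^ 2 + 1) ^ 2 * (n ^ 2) ^ 2 ≤ n ^ 6 * (n ^ 2) ^ 2 :=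
        Nat.mul_le_mul_right _ (card_box_le hn)
    _ = n ^ 10 := by ring

/-- With 2n + 1 ≤ exp(2n) and at most n⁹ slots, the number of count vectors is at most exp(2n · n⁹)
= exp(n¹⁰)². -/
theorem card_type_le {n : ℕ} (hn : 11 ≤ n) :
    (Fintype.card (Fin 2 × (Slot n → Fin (2 * n + 1))) : ℝ) ≤ 2 * Real.exp ((n : ℝ) ^ 10) ^ 2 := by
  rw [Fintype.card_prod, Fintype.card_fun, Fintype.card_fin, Fintype.card_fin]
  push_cast
  refine mul_le_mul_of_nonneg_left ?_ zero_le_two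
  have h1 : (2 * (n : ℝ) + 1) ≤ Real.exp (2 * n) := Real.add_one_le_exp _
  calc (2 * (n : ℝ) + 1) ^ Fintype.card (Slot n)
      ≤ Real.exp (2 * n) ^ Fintype.card (Slot n) := by gcongr
    _ ≤ Real.exp (2 * n) ^ (n ^ 9) :=
        pow_le_pow_right₀ (Real.one_le_exp (by positivity)) (card_slot_le hn)
    _ = Real.exp ((n : ℝ) ^ 10) ^ 2 := by
        rw [← Real.exp_nat_mul, ← Real.exp_nat_mul]
        push_cast
        ring_nf

/-- The total cost of the packing is within the bound required of a linear structure. -/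
theorem cost_le {n : ℕ} (hn : 11 ≤ n) {b κ a s c O : ℝ} (hb : 0 ≤ b)
    (ha : a ≤ 2 * Real.exp ((n : ℝ) ^ 10) ^ 2) (hs : s ≤ (n : ℝ) ^ 9) (hc0 : 0 ≤ c) (hc : c ≤ (n : ℝ) ^ 10) (hO : 0 ≤ O)
    (hκ : κ = 1 / Real.exp ((n : ℝ) ^ 20) ^ 10 * O) :
    (1 + 2 * (n : ℝ)⁻¹) * (b + a * (κ * n ^ 2 + 1)) + 1
      + ((1 + 2 * (n : ℝ)⁻¹) * (2 * b / n ^ 2 + 2 * κ * a + 1) + 1)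
      + (2 * s * (2 + c * (κ * (2 * n))) + b * (2 * n) / n ^ 2) ≤
    b * (1 + 10 * (n : ℝ)⁻¹) + Real.exp ((n : ℝ) ^ 20) + ((n : ℝ)⁻¹) ^ 10 * O := by
  have hn' : (11 : ℝ) ≤ n := by exact_mod_cast hn
  have hn0 : (0 : ℝ) < n := by linarith
  set x : ℝ := (n : ℝ)⁻¹ with hx
  have hx0 : 0 < x := inv_pos.mpr hn0
  have hx1 : x ≤ 1 / 11 := by
    rw [hx, ← one_div]
    exact one_div_le_one_div_of_le (by norm_num) hn'
  -- An intermediate scale: powers of n up to n¹⁰ are below E, the number of types is O(E²), and the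
  -- totals needed stay below E⁴ ≤ K.
  set E : ℝ := Real.exp ((n : ℝ) ^ 10) with hE
  set K : ℝ := Real.exp ((n : ℝ) ^ 20) with hK
  have hnE : (n : ℝ) ^ 10 ≤ E := by linarith [Real.add_one_le_exp ((n : ℝ) ^ 10)]
  have hE100 : 100 ≤ E := by
    refine le_trans ?_ hnE
    calc (100 : ℝ) ≤ 11 ^ 10 := by norm_num
      _ ≤ _ := by gcongr
  have hE0 : 0 < E := by linarith
  have hEK : E ^ 4 ≤ K :=
    (pow_le_pow_right₀ (by linarith) (by norm_num)).trans (exp_pow_eight_le hn)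
  have hK1 : 1 ≤ K := Real.one_le_exp (by positivity)
  have hK0 : 0 < K := by linarith
  have hκ0 : 0 ≤ κ := by rw [hκ]; positivity
  have hn9 : (n : ℝ) ^ 9 ≤ E := (pow_le_pow_right₀ (by linarith) (by norm_num)).trans hnE
  have hn2 : (n : ℝ) ^ 2 ≤ E := (pow_le_pow_right₀ (by linarith) (by norm_num)).trans hnE
  have hE2 : 100 * E ≤ E ^ 2 := by nlinarith
  have hE3 : 100 * E ^ 2 ≤ E ^ 3 := by nlinarith
  have hE4 : 100 * E ^ 3 ≤ E ^ 4 := by nlinarith [pow_pos hE0 3]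
  have hκK : κ * K ≤ x ^ 10 * O := by
    rw [hκ, mul_right_comm]
    refine mul_le_mul_of_nonneg_right ?_ hO
    rw [one_div, hx, inv_pow, inv_mul_le_iff₀ (by positivity)]
    have h1 : (n : ℝ) ^ 10 ≤ K := by nlinarith
    have h2 : K ^ 2 ≤ K ^ 10 := pow_le_pow_right₀ hK1 (by norm_num)
    rw [← div_eq_mul_inv, le_div_iff₀ (by positivity)]
    nlinarith
  have hcoef : (1 + 2 * x) * (1 + 2 * x ^ 2) + 2 * x ≤ 1 + 10 * x := by nlinarith
  have hconst : (1 + 2 * x) * (a + 1) + 2 + 4 * s ≤ K := by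
    have h1 : (1 + 2 * x) * (a + 1) ≤ (1 + 2 * x) * (2 * E ^ 2 + 1) :=
      mul_le_mul_of_nonneg_left (by linarith) (by linarith)
    have h2 : (1 + 2 * x) * (2 * E ^ 2 + 1) ≤ 2 * (2 * E ^ 2 + 1) :=
      mul_le_mul_of_nonneg_right (by linarith) (by positivity)
    linarith
  have hsc : 4 * n * s * c ≤ 4 * E ^ 2 := by
    have h1 : s * c ≤ (n : ℝ) ^ 9 * (n : ℝ) ^ 10 := mul_le_mul hs hc hc0 (by positivity)
    have h2 : (n : ℝ) ^ 10 * (n : ℝ) ^ 10 ≤ E * E :=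
      mul_le_mul hnE hnE (by positivity) hE0.le
    calc 4 * n * s * c = 4 * n * (s * c) := by ring
      _ ≤ 4 * n * ((n : ℝ) ^ 9 * (n : ℝ) ^ 10) := mul_le_mul_of_nonneg_left h1 (by positivity)
      _ = 4 * ((n : ℝ) ^ 10 * (n : ℝ) ^ 10) := by ring
      _ ≤ 4 * (E * E) := by linarith
      _ = 4 * E ^ 2 := by ring
  have hκcoef : (1 + 2 * x) * (a * (n ^ 2 + 2)) + 4 * n * s * c ≤ K := by
    have h1 : a * ((n : ℝ) ^ 2 + 2) ≤ 2 * E ^ 2 * (E + 2) :=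
      (mul_le_mul_of_nonneg_right ha (by positivity)).trans
        (mul_le_mul_of_nonneg_left (by linarith) (by positivity))
    have h2 : (1 + 2 * x) * (a * ((n : ℝ) ^ 2 + 2)) ≤ 2 * (2 * E ^ 2 * (E + 2)) :=
      (mul_le_mul_of_nonneg_left h1 (by linarith)).trans
        (mul_le_mul_of_nonneg_right (by linarith) (by positivity))
    nlinarith
  -- Sort the cost into a multiple of b, a constant and a multiple of κ. The three coefficients are
  -- at most 1 + 10x, K and K, and κK ≤ x¹⁰ O.
  have e1 : (1 + 2 * x) * (b + a * (κ * n ^ 2 + 1)) + 1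
      + ((1 + 2 * x) * (2 * b / n ^ 2 + 2 * κ * a + 1) + 1)
      + (2 * s * (2 + c * (κ * (2 * n))) + b * (2 * n) / n ^ 2)
      = b * ((1 + 2 * x) * (1 + 2 * x ^ 2) + 2 * x) + ((1 + 2 * x) * (a + 1) + 2 + 4 * s)
        + κ * ((1 + 2 * x) * (a * (n ^ 2 + 2)) + 4 * n * s * c) := by
    rw [hx]
    field_simp
    ring
  rw [e1]
  have := mul_le_mul_of_nonneg_left hcoef hb
  have := mul_le_mul_of_nonneg_left hκcoef hκ0
  linarith

/-! ### The weight vectors forming the linear structure -/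

variable {I : Type*} [Fintype I] {P : VBP2 I}

open Classical in
theorem sum_mul_finInd (z : I → ℝ) (A : Finset I) : ∑ i, z i * finInd A i = ∑ i ∈ A, z i := by
  simp [finInd]

namespace Decomposition

variable {δ : ℝ} {n : ℕ} {w : I → ℝ} {Nm : ℝ} {τ : Type*} (c : Decomposition P δ n w Nm τ)

open Classical in
/-- The weight vectors of a decomposition: the indicators of the cells of large items, and for each
type the volumes of its flat and of its steep small items. -/
noncomputable def weights : Finset (I → ℝ) :=
  (Finset.univ.image fun k : Cell n => finInd {i ∈ P.large δ | P.cell n c.q i = k}) ∪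
  ((c.act ×ˢ (Finset.univ : Finset (Fin 2))).image fun x =>
    P.flatVec δ n (c.e x.1) (P.space δ n (c.q (c.e x.1)) (c.T x.1)) (c.wt x.1) x.2) ∪
  (c.act.image fun t => P.steepVec δ n (c.e t) (P.space δ n (c.q (c.e t)) (c.T t)) (c.wt t))

theorem cell_mem_weights (k : Cell n) :
    finInd {i ∈ P.large δ | P.cell n c.q i = k} ∈ c.weights := by
  classical
  refine Finset.mem_union_left _ (Finset.mem_union_left _ (Finset.mem_image.mpr
    ⟨k, Finset.mem_univ _, ?_⟩))
  congr!

theorem flatVec_mem_weights {t : τ} (ht : t ∈ c.act) (d : Fin 2) :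
    P.flatVec δ n (c.e t) (P.space δ n (c.q (c.e t)) (c.T t)) (c.wt t) d ∈ c.weights := by
  classical
  exact Finset.mem_union_left _ (Finset.mem_union_right _ (Finset.mem_image.mpr
    ⟨(t, d), Finset.mem_product.mpr ⟨ht, Finset.mem_univ _⟩, rfl⟩))

theorem steepVec_mem_weights {t : τ} (ht : t ∈ c.act) :
    P.steepVec δ n (c.e t) (P.space δ n (c.q (c.e t)) (c.T t)) (c.wt t) ∈ c.weights := by
  classical
  exact Finset.mem_union_right _ (Finset.mem_image.mpr ⟨t, ht, rfl⟩)

theorem card_weights_le : c.weights.card ≤ Fintype.card (Cell n) + 3 * c.act.card := by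
  classical
  unfold weights
  refine (Finset.card_union_le _ _).trans ?_
  have h1 := Finset.card_union_le
    (Finset.univ.image fun k : Cell n => finInd {i ∈ P.large δ | P.cell n c.q i = k})
    ((c.act ×ˢ (Finset.univ : Finset (Fin 2))).image fun x =>
      P.flatVec δ n (c.e x.1) (P.space δ n (c.q (c.e x.1)) (c.T x.1)) (c.wt x.1) x.2)
  have h2 : (Finset.univ.image fun k : Cell n =>
      finInd {i ∈ P.large δ | P.cell n c.q i = k}).card ≤ Fintype.card (Cell n) :=
    Finset.card_image_le
  have h3 : ((c.act ×ˢ (Finset.univ : Finset (Fin 2))).image fun x =>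
      P.flatVec δ n (c.e x.1) (P.space δ n (c.q (c.e x.1)) (c.T x.1)) (c.wt x.1) x.2).card
      ≤ c.act.card * 2 :=
    Finset.card_image_le.trans (by simp [Finset.card_product])
  have h4 : (c.act.image fun t =>
      P.steepVec δ n (c.e t) (P.space δ n (c.q (c.e t)) (c.T t)) (c.wt t)).card ≤ c.act.card :=
    Finset.card_image_le
  have h5 : ∀ (p q : Finset (I → ℝ)), p = q → p.card = q.card := fun p q h => by rw [h]
  refine (Nat.add_le_add_right (le_trans (le_of_eq (h5 _ _ (by congr!))) h1) _).trans ?_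
  omega

theorem weights_cases {u : I → ℝ} (hu : u ∈ c.weights) :
    (∃ k, u = finInd {i ∈ P.large δ | P.cell n c.q i = k}) ∨
    (∃ t ∈ c.act, ∃ d,
      u = P.flatVec δ n (c.e t) (P.space δ n (c.q (c.e t)) (c.T t)) (c.wt t) d) ∨
    (∃ t ∈ c.act, u = P.steepVec δ n (c.e t) (P.space δ n (c.q (c.e t)) (c.T t)) (c.wt t)) := by
  classical
  rcases Finset.mem_union.mp hu with h | h
  · rcases Finset.mem_union.mp h with h | h
    · obtain ⟨k, -, rfl⟩ := Finset.mem_image.mp h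
      exact Or.inl ⟨k, by congr!⟩
    · obtain ⟨x, hx, rfl⟩ := Finset.mem_image.mp h
      exact Or.inr (Or.inl ⟨x.1, (Finset.mem_product.mp hx).1, x.2, rfl⟩)
  · obtain ⟨t, ht, rfl⟩ := Finset.mem_image.mp h
    exact Or.inr (Or.inr ⟨t, ht, rfl⟩)

theorem weights_nonneg (hw : ∀ i, w i ∈ Set.Icc (0 : ℝ) 1) {u : I → ℝ} (hu : u ∈ c.weights)
    (i : I) : 0 ≤ u i := by
  have hwt : ∀ t ∈ c.act, ∀ i, c.wt t i ∈ Set.Icc (0 : ℝ) 1 := fun t ht i =>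
    ⟨c.wt_nonneg t i, (c.wt_le t ht i).trans (hw i).2⟩
  rcases c.weights_cases hu with ⟨k, rfl⟩ | ⟨t, ht, d, rfl⟩ | ⟨t, ht, rfl⟩
  · exact finInd_nonneg _ _
  · exact flatVec_nonneg (hwt t ht) d i
  · exact steepVec_nonneg (hwt t ht) i

/-- The weight vectors which are positive at some large item are indicators of rectangles. -/
theorem weights_mem_rectangles
    (hq : ∀ e i j, P.box n i = P.box n j → P.key e i ≤ P.key e j → c.q e i ≤ c.q e j)
    {u : I → ℝ} (hu : u ∈ c.weights) (hpos : ∃ i ∈ P.large δ, 0 < u i) :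
    u ∈ P.rectangles δ n := by
  classical
  obtain ⟨i, hi, hui⟩ := hpos
  rcases c.weights_cases hu with ⟨k, rfl⟩ | ⟨t, ht, d, rfl⟩ | ⟨t, ht, rfl⟩
  · have hcell : ∀ i, P.cell n c.q i = k ↔
        P.box n i = k.1 ∧ ∀ e, (c.q e i : ℕ) = (k.2 e : ℕ) := by
      intro i
      simp only [cell, Prod.ext_iff, funext_iff, Fin.ext_iff]
    have hne : i ∈ ({i ∈ P.large δ | P.cell n c.q i = k} : Finset I) := by
      by_contra h
      simp [finInd, h] at hui
    have hset : ({i ∈ P.large δ | P.cell n c.q i = k} : Finset I)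
        = {i ∈ P.large δ | P.box n i = k.1 ∧ ∀ e, (c.q e i : ℕ) = (k.2 e : ℕ)} :=
      Finset.filter_congr fun i _ => hcell i
    rw [hset] at hne ⊢
    have key := P.finInd_mem_rectangles (δ := δ) k.1 (fun e i => (c.q e i : ℕ)) (fun e i j => hq e i j)
      (fun e => (k.2 e : ℕ)) ⟨i, by convert hne⟩
    convert key
  -- Flat and steep vectors vanish at large items, so only cell indicators can meet L.
  · simp [flatVec, finInd_flat_of_large hi] at hui
  · simp [steepVec, finInd_steep_of_large hi] at hui

end Decomposition

end VBP2

/-! ### The main theorem -/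

theorem mainTheorem7 {I : Type*} [Fintype I] (P : VBP2 I) (δ : ℝ)
    (hδ : δ ∈ Set.Ioo (0 : ℝ) 0.1) (hδN : ∃ n : ℕ, δ⁻¹ = (n : ℝ)) (hP : P.HugeFree δ) :
    ∃ Sstar : Finset (I → ℝ),
      (∀ u ∈ Sstar, ∀ i, 0 ≤ u i) ∧
      (Sstar.card : ℝ) ≤ vbpPhi δ * ((P.large δ).card : ℝ) ^ 4 ∧
      ∀ lam : P.MultiConfig → ℝ, P.IsFractional lam →
        P.SmallItemsIntegral δ (P.coverage lam) → P.WithSlack δ lam →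
        ∃ S : Finset (I → ℝ), P.IsLinearStructure δ (vbpPhi δ) lam S ∧
          ∀ u ∈ S, (∃ i ∈ P.large δ, 0 < u i) → u ∈ Sstar := by
  classical
  obtain ⟨n, hδn⟩ := hδN
  have hδ0 : 0 < δ := hδ.1
  have hδ' : δ = (n : ℝ)⁻¹ := by rw [← hδn, inv_inv]
  have hn : 11 ≤ n := by
    have h1 : (10 : ℝ) < n := by
      rw [← hδn, lt_inv_comm₀ (by norm_num) hδ0]
      have := hδ.2
      norm_num at this ⊢
      exact this
    exact_mod_cast h1
  have hn' : (11 : ℝ) ≤ n := by exact_mod_cast hn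
  set E : ℝ := Real.exp ((n : ℝ) ^ 10) with hE
  have hnE : (n : ℝ) ^ 10 ≤ E := by linarith [Real.add_one_le_exp ((n : ℝ) ^ 10)]
  have hE100 : 100 ≤ E := by
    refine le_trans ?_ hnE
    calc (100 : ℝ) ≤ 11 ^ 10 := by norm_num
      _ ≤ _ := by gcongr
  have hEK : E ^ 3 ≤ vbpPhi δ := by
    rw [vbpPhi_eq hδn]
    exact (pow_le_pow_right₀ (by linarith) (by norm_num)).trans (exp_pow_eight_le hn)
  -- The rectangles are chosen before the fractional solution: they depend only on the instance and
  -- on n.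
  refine ⟨P.rectangles δ n, fun u hu => P.rectangles_nonneg hu, ?_, fun lam hlam hint hslack => ?_⟩
  · have h1 : ((P.rectangles δ n).card : ℝ) ≤ (n : ℝ) ^ 6 * ((P.large δ).card : ℝ) ^ 4 := by
      exact_mod_cast (P.card_rectangles_le δ n).trans
        (Nat.mul_le_mul_right _ (VBP2.card_box_le hn))
    refine h1.trans (mul_le_mul_of_nonneg_right ?_ (by positivity))
    have h2 : (n : ℝ) ^ 6 ≤ (n : ℝ) ^ 10 := pow_le_pow_right₀ (by linarith) (by norm_num)
    have h3 : E ≤ E ^ 3 := le_self_pow₀ (by linarith) (by norm_num)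
    linarith
  obtain ⟨c, hc⟩ := VBP2.exists_decomposition hδ0 hδn (by omega : 2 ≤ n) hlam hslack
  have hl := hlam.isSummableWeight
  have hw : ∀ i, P.coverage lam i ∈ Set.Icc (0 : ℝ) 1 := fun i =>
    ⟨hl.coverage_nonneg i, hlam.coverage_le i⟩
  have hwt : ∀ t ∈ c.act, ∀ i, c.wt t i ∈ Set.Icc (0 : ℝ) 1 := fun t ht i =>
    ⟨c.wt_nonneg t i, (c.wt_le t ht i).trans (hw i).2⟩
  have hact : (c.act.card : ℝ) ≤ 2 * E ^ 2 :=
    le_trans (by exact_mod_cast Finset.card_le_univ c.act) (VBP2.card_type_le hn)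
  have hcellc : (Fintype.card (VBP2.Cell n) : ℝ) ≤ (n : ℝ) ^ 10 := by
    exact_mod_cast VBP2.card_cell_le hn
  have hslotc : (Fintype.card (VBP2.Slot n) : ℝ) ≤ (n : ℝ) ^ 9 := by
    exact_mod_cast VBP2.card_slot_le hn
  refine ⟨c.weights, ⟨fun u hu => c.weights_nonneg hw hu, ?_, ?_⟩,
    fun u hu hpos => c.weights_mem_rectangles hc hu hpos⟩
  · have h1 : (c.weights.card : ℝ) ≤ Fintype.card (VBP2.Cell n) + 3 * c.act.card := by
      exact_mod_cast c.card_weights_le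
    nlinarith
  · intro z β hz _ hβ hsupp hcon
    have hβ' : β ∈ Set.Icc (0 : ℝ) 1 := ⟨le_trans (by positivity) hβ.1, hβ.2⟩
    set κ : ℝ := 1 / vbpPhi δ ^ 10 * (P.OPT : ℝ) with hκ
    have hκ0 : 0 ≤ κ := by
      have : 0 < vbpPhi δ := Real.exp_pos _
      positivity
    have hcon' : ∀ u ∈ c.weights, ∀ b, P.tol u ≤ b →
        ∑ i, z i * u i ≤ β * ∑ i, P.coverage lam i * u i + κ * b := fun u hu b hb =>
      (hcon u hu).trans (add_le_add le_rfl (mul_le_mul_of_nonneg_left hb hκ0))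
    -- A configuration has at most 2/δ = 2n large items, so the cell constraints hold with error κ ·
    -- 2n.
    have hpack := c.pack_of_constraints (by omega) hδ'.le hw hint z hz hsupp hβ' hκ0
      (ε := κ * (2 * n)) (by positivity) (fun k => ?_) (fun t ht d => ?_) (fun t ht => ?_)
    · refine (VBP2.OPTf_le_of_pack hpack).trans ?_
      have h := VBP2.cost_le hn (b := β * P.norm1 lam) (κ := κ) (a := c.act.card)
        (s := Fintype.card (VBP2.Slot n)) (c := Fintype.card (VBP2.Cell n)) (O := P.OPT)
        (mul_nonneg hβ'.1 hl.norm1_nonneg) hact hslotc (Nat.cast_nonneg _)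
        hcellc (Nat.cast_nonneg _) (by rw [hκ, vbpPhi_eq hδn])
      rw [vbpPhi_eq hδn]
      refine le_trans (le_of_eq ?_) (h.trans (le_of_eq ?_))
      · ring
      · rw [← hδ']
        ring
    · have h1 := hcon' _ (c.cell_mem_weights k) (2 * n) (VBP2.tol_le fun C => by
        rw [← hδn]
        exact VBP2.card_large_config_le hδ0 C _ (Finset.filter_subset _ _))
      rw [VBP2.sum_mul_finInd, VBP2.sum_mul_finInd] at h1
      convert h1
    · exact hcon' _ (c.flatVec_mem_weights ht d) _ (VBP2.tol_flatVec_le (hwt t ht)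
        (c.space_nonneg t ht) (c.space_slack t ht) d)
    · exact hcon' _ (c.steepVec_mem_weights ht) _ (VBP2.tol_steepVec_le (hwt t ht))
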